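/- Setting. Let $\Omega\subset\mathbb R$ be compact, $m_\Omega=\sup_{\omega\in\Omega}|\omega|$, and let $\mathrm B(\Omega)$ be the space of $f\in L^2(\mathbb R)$ whose Fourier transform $\hat f(\omega)=\int f(x)e^{-i\omega x}\,dx$ is supported in $\Omega$ (such $f$ are identified with their continuous representatives). Let $s\in\mathbb N$, $\tau\in(0,1]$, $\delta\in\mathbb R$. A bunched sampling set with density $\delta$ and bunch width $\tau\delta$ is a family $\{x_{n,m}\}_{n\in I,\,0\le m\le s}\subset\mathbb R$, $I\neq\emptyset$, such that: the centres $x_{n,0}$ are pairwise distinct and have no finite accumulation point; $\delta=\sup_{x\in\mathbb R}\inf_{n\in I}|x-x_{n,0}|$; and there are $h_n\ge 0$ with $\sup_n h_n=\tau\delta$ such that for every $n$ the points $x_{n,0},\dots,x_{n,s}$ are distinct and lie in $[x_{n,0}-h_n,x_{n,0}+h_n]\subseteq V_n$, where $V_n=\{x:|x-x_{n,0}|\le|x-x_{k,0}|\ \forall k\in I\}$ is the Voronoi region of $x_{n,0}$. For a function $f$ let $p_n(f)$ be the polynomial of degree at most $s$ with $p_n(f)(x_{n,m})=f(x_{n,m})$,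 $0\le m\le s$, and let $\mathcal P_n(f)=p_n(f)\,\mathbb 1_{V_n}$. We say that $\{\mathcal P_n\}$ is a non-orthogonal fusion frame for $\mathrm B(\Omega)$ (with weights $1$) with bounds $A,B>0$ if each $\mathcal P_n$ is idempotent and is a bounded linear operator with closed range from $\mathrm B(\Omega)$ to $\{g\in L^2(\mathbb R):\operatorname{supp} g\subseteq V_n\}$, and $$A\|f\|^2\le\sum_{n\in I}\|\mathcal P_n(f)\|^2\le B\|f\|^2\qquad\text{for all } f\in\mathrm B(\Omega).$$ Let $\tilde H_{s,\tau}$ be the inverse function of $$\tilde h_{s,\tau}(z)=\frac{(1+\tau)^s z^{s+1}}{(s+1)!}\Bigl(1+\frac{4z}{\pi}\Bigr),\qquad z\in(0,\infty).$$ Statement. (i) For every fixed $\tau\in(0,1]$, $\displaystyle \tilde H_{s,\tau}(1)\sim\frac{s+1}{(1+\tau)e}$ as $s\to\infty$. (ii) There is $S\in\mathbb N$ such that for all $s\ge S$, all $\tau\in(0,1]$, all compact $\Omega$ and all bunched sampling sets with density $\delta$ and bunch width $\tau\delta$: if $$\delta\, m_\Omega<\frac{s+1}{(1+\tau)e},$$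 then $\{\mathcal P_n\}$ is a non-orthogonal fusion frame for $\mathrm B(\Omega)$ with some bounds $A,B>0$ satisfying $B\le(1+\tilde h_{s,\tau}(\delta m_\Omega))^2$ and, provided that $\delta m_\Omega<\tilde H_{s,\tau}(1)$, also $A\ge(1-\tilde h_{s,\tau}(\delta m_\Omega))^2$. (iii) For every $\varepsilon\in(0,1)$ there is $S\in\mathbb N$ such that for all $s\ge S$, all $\tau\in(0,1]$, all compact $\Omega$ and all bunched sampling sets with density $\delta$ and bunch width $\tau\delta$: if $\displaystyle\delta\, m_\Omega<(1-\varepsilon)\frac{s+1}{(1+\tau)e}$, then $\{\mathcal P_n\}$ is a non-orthogonal fusion frame for $\mathrm B(\Omega)$ with some bounds $A,B>0$ satisfying both $A\ge(1-\tilde h_{s,\tau}(\delta m_\Omega))^2$ and $B\le(1+\tilde h_{s,\tau}(\delta m_\Omega))^2$. -/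

import Mathlib

open MeasureTheory Filter Topology FourierTransform
open scoped ENNReal

universe u

noncomputable section

/-- The space `B(Ω)` of `Ω`-bandlimited functions, as a subspace of `L²(ℝ)`.
In terms of the transform `f̂(ω) = ∫ f(x) e^{-iωx} dx` it consists of those `f` for which `f̂`
vanishes almost everywhere outside `Ω`. Mathlib's transform is `𝓕 f ξ = f̂(2πξ)`. -/
def bandlimited (Ω : Set ℝ) : Submodule ℂ (Lp ℂ 2 (volume : Measure ℝ)) where
  carrier := {f | ∀ᵐ ξ : ℝ, 2 * Real.pi * ξ ∉ Ω → (𝓕 f : Lp ℂ 2 (volume : Measure ℝ)) ξ = 0}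
  add_mem' := by
    intro f g hf hg
    simp only [Set.mem_ofPred_eq] at *
    rw [FourierAdd.fourier_add]
    filter_upwards [hf, hg, Lp.coeFn_add (𝓕 f) (𝓕 g)] with ξ h1 h2 h3 h4
    rw [h3, Pi.add_apply, h1 h4, h2 h4, add_zero]
  zero_mem' := by
    have h : (𝓕 (0 : Lp ℂ 2 (volume : Measure ℝ)) : Lp ℂ 2 (volume : Measure ℝ)) = 0 :=
      (Lp.fourierTransformₗᵢ ℝ ℂ).map_zero
    simp only [Set.mem_ofPred_eq]
    rw [h]
    filter_upwards [Lp.coeFn_zero ℂ 2 (volume : Measure ℝ)] with ξ h1 _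
    rw [h1, Pi.zero_apply]
  smul_mem' := by
    intro c f hf
    simp only [Set.mem_ofPred_eq] at *
    rw [FourierSMul.fourier_smul]
    filter_upwards [hf, Lp.coeFn_smul c (𝓕 f)] with ξ h1 h3 h4
    rw [h3, Pi.smul_apply, h1 h4, smul_zero]

/-- The pointwise values of a bandlimited function: the function
`x ↦ ∫ 𝓕 f ξ e^{2πi x ξ} dξ = (2π)⁻¹ ∫_Ω f̂(ω) e^{iωx} dω`, which is the continuous
representative of `f` (see `continuous_pointValue` and `pointValue_ae_eq`). -/
def pointValue (f : Lp ℂ 2 (volume : Measure ℝ)) : ℝ → ℂ :=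
  𝓕⁻ ((𝓕 f : Lp ℂ 2 (volume : Measure ℝ)) : ℝ → ℂ)

theorem integrable_fourier_of_mem_bandlimited {Ω : Set ℝ} (hΩ : IsCompact Ω)
    {f : Lp ℂ 2 (volume : Measure ℝ)} (hf : f ∈ bandlimited Ω) :
    Integrable ((𝓕 f : Lp ℂ 2 (volume : Measure ℝ)) : ℝ → ℂ) := by
  set F : Lp ℂ 2 (volume : Measure ℝ) := 𝓕 f
  obtain ⟨R, hR⟩ := hΩ.isBounded.exists_norm_le
  have hF : MemLp F 2 (volume : Measure ℝ) := Lp.memLp F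
  have h1 : IntegrableOn F (Set.Icc (-R) R) := by
    have : IsFiniteMeasure ((volume : Measure ℝ).restrict (Set.Icc (-R) R)) := by
      constructor; simp
    exact (hF.restrict _).integrable (by norm_num)
  have h2 : (Set.Icc (-R) R).indicator F =ᵐ[volume] F := by
    have hf' : ∀ᵐ ξ : ℝ, 2 * Real.pi * ξ ∉ Ω → F ξ = 0 := hf
    filter_upwards [hf'] with ξ h
    by_cases hξ : ξ ∈ Set.Icc (-R) R
    · rw [Set.indicator_of_mem hξ]
    · rw [Set.indicator_of_notMem hξ, h]
      intro hmem
      apply hξ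
      have h3 := hR _ hmem
      rw [Real.norm_eq_abs, abs_mul, abs_of_pos (by positivity : 0 < 2 * Real.pi)] at h3
      have h4 : |ξ| ≤ 2 * Real.pi * |ξ| := by
        nlinarith [abs_nonneg ξ, Real.pi_gt_three]
      exact abs_le.mp (h4.trans h3)
  exact (h1.integrable_indicator measurableSet_Icc).congr h2

theorem continuous_pointValue {Ω : Set ℝ} (hΩ : IsCompact Ω)
    {f : Lp ℂ 2 (volume : Measure ℝ)} (hf : f ∈ bandlimited Ω) : Continuous (pointValue f) := by
  have h := integrable_fourier_of_mem_bandlimited hΩ hf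
  exact VectorFourier.fourierIntegral_continuous Real.continuous_fourierChar
    (by fun_prop) h

theorem pointValue_ae_eq {Ω : Set ℝ} (hΩ : IsCompact Ω)
    {f : Lp ℂ 2 (volume : Measure ℝ)} (hf : f ∈ bandlimited Ω) :
    pointValue f =ᵐ[volume] f := by
  have hF := integrable_fourier_of_mem_bandlimited hΩ hf
  have hc := continuous_pointValue hΩ hf
  refine ae_eq_of_integral_contDiff_smul_eq (hc.locallyIntegrable)
    ((Lp.memLp f).locallyIntegrable (by norm_num)) ?_
  intro g hg hgs
  have hgs' : HasCompactSupport (fun x => (g x : ℂ)) := hgs.comp_left (g := fun t : ℝ => (t : ℂ)) rfl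
  let φ : SchwartzMap ℝ ℂ := hgs'.toSchwartzMap
    (Complex.ofRealCLM.contDiff.comp hg)
  have hφ : ∀ x, φ x = (g x : ℂ) := fun x => rfl
  have key := Lp.fourierInv_toTemperedDistribution_eq (𝓕 f : Lp ℂ 2 (volume : Measure ℝ))
  rw [FourierPair.fourierInv_fourier_eq] at key
  have key2 := congrArg (fun T => T φ) key
  simp only [TemperedDistribution.fourierInv_apply, Lp.toTemperedDistribution_apply] at key2
  have flip : ∫ x, φ x • pointValue f x =
      ∫ ξ, (𝓕⁻ φ : SchwartzMap ℝ ℂ) ξ • (𝓕 f : Lp ℂ 2 (volume : Measure ℝ)) ξ := by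
    have := VectorFourier.integral_fourierIntegral_smul_eq_flip (e := Real.fourierChar)
      (L := -(innerₗ ℝ)) (μ := volume) (ν := volume) (f := (φ : ℝ → ℂ))
      (g := ((𝓕 f : Lp ℂ 2 (volume : Measure ℝ)) : ℝ → ℂ))
      Real.continuous_fourierChar (by simp only [LinearMap.neg_apply]; fun_prop)
      φ.integrable hF
    rw [SchwartzMap.fourierInv_coe]
    have hL : (-(innerₗ ℝ)).flip = -(innerₗ ℝ) := by
      ext; simp
    rw [hL] at this
    exact this.symm
  have e1 : ∀ u : ℝ → ℂ, (fun x => g x • u x) = fun x => φ x • u x := by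
    intro u; funext x; rw [hφ]; simp
  rw [e1, e1, flip, key2]

/-- `m_Ω = sup_{ω ∈ Ω} |ω|`. -/
def bandRadius (Ω : Set ℝ) : ℝ := sSup ((fun ω : ℝ => |ω|) '' Ω)

/-- The Voronoi region `V_n` of the point `y n` in the family `y`. -/
def voronoi {I : Type*} (y : I → ℝ) (n : I) : Set ℝ := {t | ∀ k, |t - y n| ≤ |t - y k|}

/-- `x n m`, `n ∈ I`, `0 ≤ m ≤ s`, is a bunched sampling set with density `δ` and bunch width
`τ δ`. The centres `x n 0` are pairwise distinct and have no finite accumulation point. -/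
structure IsBunchedSamplingSet {I : Type*} (s : ℕ) (x : I → Fin (s + 1) → ℝ) (δ τ : ℝ) :
    Prop where
  nonempty : Nonempty I
  centres_injective : Function.Injective fun n => x n 0
  centres_locallyFinite : ∀ R : ℝ, {n | |x n 0| ≤ R}.Finite
  density : IsLUB (Set.range fun t : ℝ => ⨅ n, |t - x n 0|) δ
  bunch_injective : ∀ n, Function.Injective (x n)
  bunches : ∃ h : I → ℝ, (∀ n, 0 ≤ h n) ∧
    (∀ n, Set.Icc (x n 0 - h n) (x n 0 + h n) ⊆ voronoi (fun k => x k 0) n) ∧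
    (∀ n m, x n m ∈ Set.Icc (x n 0 - h n) (x n 0 + h n)) ∧
    IsLUB (Set.range h) (τ * δ)

/-- The subspace of `L²(ℝ)` of functions supported in the closed set `V`. -/
def supportedIn (V : Set ℝ) : Submodule ℂ (Lp ℂ 2 (volume : Measure ℝ)) where
  carrier := {g | ∀ᵐ t : ℝ, t ∉ V → g t = 0}
  add_mem' := by
    intro f g hf hg
    simp only [Set.mem_ofPred_eq] at *
    filter_upwards [hf, hg, Lp.coeFn_add f g] with t h1 h2 h3 h4
    rw [h3, Pi.add_apply, h1 h4, h2 h4, add_zero]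
  zero_mem' := by
    simp only [Set.mem_ofPred_eq]
    filter_upwards [Lp.coeFn_zero ℂ 2 (volume : Measure ℝ)] with t h1 _
    rw [h1, Pi.zero_apply]
  smul_mem' := by
    intro c f hf
    simp only [Set.mem_ofPred_eq] at *
    filter_upwards [hf, Lp.coeFn_smul c f] with t h1 h3 h4
    rw [h3, Pi.smul_apply, h1 h4, smul_zero]

/-- `g ↦ p(g) 𝟙_V`, where `p(g)` is the polynomial of degree at most `s` which interpolates `g`
at the `s + 1` nodes, as a linear operator on functions with pointwise values. -/
def interpOp {s : ℕ} (V : Set ℝ) (nodes : Fin (s + 1) → ℝ) : Module.End ℂ (ℝ → ℂ) where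
  toFun g := V.indicator fun t =>
    (Lagrange.interpolate Finset.univ (fun m => (nodes m : ℂ)) fun m => g (nodes m)).eval (t : ℂ)
  map_add' g₁ g₂ := by
    have h : (fun m => (g₁ + g₂) (nodes m)) =
        (fun m => g₁ (nodes m)) + fun m => g₂ (nodes m) := rfl
    rw [h, map_add]
    funext t
    by_cases ht : t ∈ V <;> simp [ht]
  map_smul' c g := by
    have h : (fun m => (c • g) (nodes m)) = c • fun m => g (nodes m) := rfl
    rw [h, map_smul]
    funext t
    by_cases ht : t ∈ V <;> simp [ht]

/-- The operators `P n` with closed range and the positive weights `v n` satisfy the fusion frame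
inequalities on the Hilbert space `H` with positive bounds `A` and `B`. -/
structure FusionFrameBounds {I H : Type*} {K : I → Type*} [NormedAddCommGroup H]
    [NormedSpace ℂ H] [∀ n, NormedAddCommGroup (K n)] [∀ n, NormedSpace ℂ (K n)]
    (v : I → ℝ) (P : ∀ n, H →L[ℂ] K n) (A B : ℝ) : Prop where
  lower_pos : 0 < A
  upper_pos : 0 < B
  weight_pos : ∀ n, 0 < v n
  closed_range : ∀ n, IsClosed (Set.range (P n))
  summable : ∀ f : H, Summable fun n => v n * ‖P n f‖ ^ 2
  lower : ∀ f : H, A * ‖f‖ ^ 2 ≤ ∑' n, v n * ‖P n f‖ ^ 2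
  upper : ∀ f : H, ∑' n, v n * ‖P n f‖ ^ 2 ≤ B * ‖f‖ ^ 2

/-- The interpolation operators `P_n f = p_n(f) 𝟙_{V_n}` are idempotent, are bounded linear
operators from `B(Ω)` to `L²`-functions supported in `V_n`, and form a non-orthogonal fusion
frame for `B(Ω)` with weights `1` and frame bounds `A` and `B`. -/
def IsBunchedFusionFrame {I : Type*} (Ω : Set ℝ) (s : ℕ) (x : I → Fin (s + 1) → ℝ)
    (A B : ℝ) : Prop :=
  (∀ n, IsIdempotentElem (interpOp (voronoi (fun k => x k 0) n) (x n))) ∧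
  ∃ P : ∀ n, bandlimited Ω →L[ℂ] supportedIn (voronoi (fun k => x k 0) n),
    (∀ n (f : bandlimited Ω), ((P n f : Lp ℂ 2 (volume : Measure ℝ)) : ℝ → ℂ) =ᵐ[volume]
      interpOp (voronoi (fun k => x k 0) n) (x n) (pointValue f)) ∧
    FusionFrameBounds (fun _ => 1) P A B

/-- `h̃_{s,τ}(z) = (1+τ)^s z^{s+1} / (s+1)! · (1 + 4z/π)`. -/
def hTilde (s : ℕ) (τ z : ℝ) : ℝ :=
  (1 + τ) ^ s * z ^ (s + 1) / ((s + 1).factorial : ℝ) * (1 + 4 * z / Real.pi)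

/-- `H̃_{s,τ}`, the inverse function of the bijection `h̃_{s,τ} : (0,∞) → (0,∞)`. -/
def HTilde (s : ℕ) (τ : ℝ) : ℝ → ℝ := Function.invFunOn (hTilde s τ) (Set.Ioi 0)

end

/-! The Voronoi cells tile the line up to null sets, so everything reduces to showing that the
piecewise interpolants of `f` differ from `f` in `L²` by at most `η‖f‖` with `η < 1`; the frame
bounds are then `(1 ± η)²`.

On one cell, the Lagrange remainder is at most `M / (s+1)!` times `|t - x₀| (|t - x₀| + τδ)^s`,
where `M` is the maximum of the `(s+1)`-st derivative there. Integrating the square of this weight,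
rather than using its maximum, gains a factor of order `1/(2s+1)`. Wirtinger's inequality replaces
`M²` by means of the derivatives of orders `s+1` and `s+2`. Summation over cells and Bernstein's
inequality give `η = √((1+τ)/(2s+1)) · h̃(δ m_Ω)` (`interpolation_error`).

The gain is what reaches the sharp threshold. By Stirling, `h̃` at `(s+1)/((1+τ)e)` grows like `√s`,
so `h̃` alone need not be below `1`; the extra factor absorbs this growth
(`sqrt_mul_hTilde_lt_one`). For `s ≥ 1` one has `η ≤ h̃`, whence the bounds stated with `h̃`. At a
fixed fraction `c ≠ 1` of the threshold, the factor `c^(s+1)` beats every power of `s`; this gives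
the asymptotics of `H̃(1)` and the uniform bound `h̃ < 1` needed for the version with `ε`. -/

/-! ### Remainder of Lagrange interpolation. -/

/-- Iterated Rolle theorem. -/
theorem exists_zero_of_strictMono_zeros {a b : ℝ} (n : ℕ) (F : ℕ → ℝ → ℝ)
    (hF : ∀ k t, HasDerivAt (F k) (F (k + 1) t) t) (z : Fin (n + 1) → ℝ) (hz : StrictMono z)
    (hzab : ∀ i, z i ∈ Set.Icc a b) (hz0 : ∀ i, F 0 (z i) = 0) :
    ∃ ξ ∈ Set.Icc a b, F n ξ = 0 := by
  induction n generalizing F with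
  | zero => exact ⟨z 0, hzab 0, hz0 0⟩
  | succ n ih =>
    have hr : ∀ i : Fin (n + 1), ∃ c ∈ Set.Ioo (z i.castSucc) (z i.succ), F 1 c = 0 := fun i =>
      exists_hasDerivAt_eq_zero (hz i.castSucc_lt_succ)
        (fun t _ => (hF 0 t).continuousAt.continuousWithinAt)
        ((hz0 _).trans (hz0 _).symm) fun t _ => hF 0 t
    choose c hc hc0 using hr
    refine ih (fun k => F (k + 1)) (fun k => hF (k + 1)) c ?_ ?_ hc0
    · intro i j hij
      have h1 : z i.succ ≤ z j.castSucc := hz.monotone (by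
        rw [Fin.le_def]; simpa using Nat.succ_le_of_lt hij)
      exact (hc i).2.trans_le (h1.trans (hc j).1.le)
    · exact fun i => ⟨(hzab _).1.trans (hc i).1.le, (hc i).2.le.trans (hzab _).2⟩

/-- The remainder of Lagrange interpolation. -/
theorem exists_sub_eval_interpolate_eq {a b : ℝ} {s : ℕ} (F : ℕ → ℝ → ℝ)
    (hF : ∀ k t, HasDerivAt (F k) (F (k + 1) t) t) {x : Fin (s + 1) → ℝ}
    (hx : Function.Injective x) (hxab : ∀ m, x m ∈ Set.Icc a b) {t : ℝ} (ht : t ∈ Set.Icc a b) :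
    ∃ ξ ∈ Set.Icc a b,
      F 0 t - (Lagrange.interpolate Finset.univ x fun m => F 0 (x m)).eval t =
        F (s + 1) ξ / ((s + 1).factorial : ℝ) * ∏ m, (t - x m) := by
  set p := Lagrange.interpolate Finset.univ x fun m => F 0 (x m) with hp
  have hpx : ∀ m, p.eval (x m) = F 0 (x m) := fun m =>
    Lagrange.eval_interpolate_at_node _ hx.injOn (Finset.mem_univ m)
  by_cases htx : ∃ m, t = x m
  · obtain ⟨m, rfl⟩ := htx
    refine ⟨x m, ht, ?_⟩
    rw [hpx, sub_self, Finset.prod_eq_zero (Finset.mem_univ m) (sub_self _), mul_zero]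
  push Not at htx
  set w := Lagrange.nodal Finset.univ x with hw
  have hwe : ∀ u, w.eval u = ∏ m, (u - x m) := fun u => Lagrange.eval_nodal
  have hwt : w.eval t ≠ 0 := by
    rw [hwe]; exact Finset.prod_ne_zero_iff.2 fun m _ => sub_ne_zero.2 (htx m)
  set c := (F 0 t - p.eval t) / w.eval t with hc
  set q := p + Polynomial.C c * w with hq
  set Z : Finset ℝ := insert t (Finset.univ.image x) with hZ
  have hZc : Z.card = s + 1 + 1 := by
    rw [hZ, Finset.card_insert_of_notMem, Finset.card_image_of_injective _ hx, Finset.card_univ,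
      Fintype.card_fin]
    simpa using fun m => (htx m).symm
  have hZm : ∀ u ∈ Z, u ∈ Set.Icc a b ∧ F 0 u - q.eval u = 0 := by
    intro u hu
    rw [hZ, Finset.mem_insert, Finset.mem_image] at hu
    rcases hu with rfl | ⟨m, -, rfl⟩
    · refine ⟨ht, ?_⟩
      rw [hq, Polynomial.eval_add, Polynomial.eval_mul, Polynomial.eval_C, hc,
        div_mul_cancel₀ _ hwt]
      ring
    · refine ⟨hxab m, ?_⟩
      rw [hq, Polynomial.eval_add, Polynomial.eval_mul, Polynomial.eval_C, hpx, hwe,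
        Finset.prod_eq_zero (Finset.mem_univ m) (sub_self _)]
      ring
  obtain ⟨ξ, hξ, h0⟩ := exists_zero_of_strictMono_zeros (a := a) (b := b) (s + 1)
    (fun k u => F k u - (Polynomial.derivative^[k] q).eval u)
    (fun k u => by
      rw [Function.iterate_succ_apply']
      exact (hF k u).sub ((Polynomial.derivative^[k] q).hasDerivAt u))
    (Z.orderEmbOfFin hZc) (OrderEmbedding.strictMono _)
    (fun i => (hZm _ (Finset.orderEmbOfFin_mem _ _ _)).1)
    (fun i => (hZm _ (Finset.orderEmbOfFin_mem _ _ _)).2)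
  refine ⟨ξ, hξ, ?_⟩
  have hwd : w.natDegree = s + 1 := by
    rw [hw, Lagrange.natDegree_nodal, Finset.card_univ, Fintype.card_fin]
  have hwm : w.Monic := Lagrange.nodal_monic
  have hpd : p.natDegree < s + 1 := by
    have h := Lagrange.degree_interpolate_lt (s := Finset.univ) (fun m => F 0 (x m)) hx.injOn
    rw [Finset.card_univ, Fintype.card_fin] at h
    by_cases hp0 : p = 0
    · rw [hp0]; simp
    · exact (Polynomial.natDegree_lt_iff_degree_lt hp0).2 h
  have hqd : Polynomial.derivative^[s + 1] q = Polynomial.C (c * ((s + 1).factorial : ℝ)) := by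
    rw [hq, iterate_map_add, Polynomial.iterate_derivative_eq_zero hpd, zero_add,
      Polynomial.iterate_derivative_C_mul]
    have h1 : Polynomial.derivative^[s + 1] w = Polynomial.C ((s + 1).factorial : ℝ) := by
      have h2 : (Polynomial.derivative^[s + 1] w).natDegree ≤ 0 := by
        have := Polynomial.natDegree_iterate_derivative w (s + 1)
        omega
      rw [Polynomial.eq_C_of_natDegree_le_zero h2, Polynomial.coeff_iterate_derivative, zero_add,
        ← hwd, Polynomial.coeff_natDegree, hwm.leadingCoeff, Nat.descFactorial_self]
      simp
    rw [h1, Polynomial.C_mul]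
  rw [hqd, Polynomial.eval_C, sub_eq_zero] at h0
  have hf : ((s + 1).factorial : ℝ) ≠ 0 := by positivity
  rw [h0, mul_div_cancel_right₀ _ hf, ← hwe, hc, div_mul_cancel₀ _ hwt]

theorem eval_basis_ofReal {s : ℕ} (x : Fin (s + 1) → ℝ) (m : Fin (s + 1)) (t : ℝ) :
    (Lagrange.basis Finset.univ (fun m => (x m : ℂ)) m).eval (t : ℂ) =
      ((Lagrange.basis Finset.univ x m).eval t : ℝ) := by
  simp only [Lagrange.basis, Lagrange.basisDivisor, Polynomial.eval_prod, Polynomial.eval_mul,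
    Polynomial.eval_C, Polynomial.eval_sub, Polynomial.eval_X]
  push_cast
  rfl

/-- The mean value form of the remainder fails for complex values, so the error at the fixed point
`t` is rotated to be a nonnegative real and the real remainder is applied to `Re (c F)`.
Interpolation commutes with this since the nodes are real. -/
theorem norm_sub_eval_interpolate_le {a b M : ℝ} {s : ℕ} (F : ℕ → ℝ → ℂ)
    (hF : ∀ k t, HasDerivAt (F k) (F (k + 1) t) t) {x : Fin (s + 1) → ℝ}
    (hx : Function.Injective x) (hxab : ∀ m, x m ∈ Set.Icc a b)
    (hM : ∀ ξ ∈ Set.Icc a b, ‖F (s + 1) ξ‖ ≤ M) {t : ℝ} (ht : t ∈ Set.Icc a b) :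
    ‖F 0 t - (Lagrange.interpolate Finset.univ (fun m => (x m : ℂ)) fun m => F 0 (x m)).eval
      (t : ℂ)‖ ≤ M / ((s + 1).factorial : ℝ) * ∏ m, |t - x m| := by
  set d := F 0 t - (Lagrange.interpolate Finset.univ (fun m => (x m : ℂ)) fun m =>
    F 0 (x m)).eval (t : ℂ) with hd
  obtain ⟨c, hc1, hc⟩ : ∃ c : ℂ, ‖c‖ = 1 ∧ c * d = ‖d‖ := by
    by_cases h : d = 0
    · exact ⟨1, by simp, by simp [h]⟩
    · refine ⟨‖d‖ / d, ?_, ?_⟩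
      · have : ‖d‖ ≠ 0 := norm_ne_zero_iff.2 h
        simp [this]
      · field_simp
  obtain ⟨ξ, hξ, h⟩ := exists_sub_eval_interpolate_eq (fun k u => (c * F k u).re)
    (fun k u => by
      have h1 := (hF k u).const_mul c
      exact Complex.reCLM.hasFDerivAt.comp_hasDerivAt u h1) hx hxab ht
  have h2 : (c * F 0 t).re - (Lagrange.interpolate Finset.univ x fun m =>
      (c * F 0 (x m)).re).eval t = ‖d‖ := by
    have h3 : ((c * d).re : ℝ) = ‖d‖ := by rw [hc, Complex.ofReal_re]
    rw [← h3, hd]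
    simp only [Lagrange.interpolate_apply, Polynomial.eval_finsetSum, Polynomial.eval_mul,
      Polynomial.eval_C, eval_basis_ofReal, mul_sub, Complex.sub_re, Finset.mul_sum,
      Complex.re_sum, ← mul_assoc, Complex.re_mul_ofReal]
  rw [h2] at h
  rw [h]
  calc _ ≤ |(c * F (s + 1) ξ).re / ((s + 1).factorial : ℝ) * ∏ m, (t - x m)| := le_abs_self _
    _ = |(c * F (s + 1) ξ).re| / ((s + 1).factorial : ℝ) * ∏ m, |t - x m| := by
      rw [abs_mul, abs_div, Finset.abs_prod, Nat.abs_cast]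
    _ ≤ _ := by
      gcongr
      calc _ ≤ ‖c * F (s + 1) ξ‖ := Complex.abs_re_le_norm _
        _ ≤ M := by rw [norm_mul, hc1, one_mul]; exact hM ξ hξ

/-! ### Wirtinger's inequality. -/

/-- A Riccati argument: `φ = -k tan(k(t - c))` solves `φ' = -k² - φ²`, so `|u' - φu|² ≥ 0` says
`(φ|u|²)' ≤ |u'|² - k²|u|²`. Integrate. The strict bound on `k (b - a)` keeps the tangent finite on
the closed interval. -/
theorem sq_mul_integral_norm_sq_le {u u' : ℝ → ℂ} (hu : ∀ t, HasDerivAt u (u' t) t)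
    (hu' : Continuous u') {a b k : ℝ} (hab : a ≤ b) (hk : 0 ≤ k) (hkL : k * (b - a) < Real.pi / 2)
    (h0 : u a = 0 ∨ u b = 0) :
    k ^ 2 * ∫ t in a..b, ‖u t‖ ^ 2 ≤ ∫ t in a..b, ‖u' t‖ ^ 2 := by
  have huc : Continuous u := continuous_iff_continuousAt.2 fun t => (hu t).continuousAt
  -- Taking `c` at the endpoint opposite to the zero of `u` kills both boundary terms.
  obtain ⟨c, hc, hcW⟩ : ∃ c ∈ Set.Icc a b,
      -k * Real.tan (k * (b - c)) * ‖u b‖ ^ 2 - -k * Real.tan (k * (a - c)) * ‖u a‖ ^ 2 = 0 := by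
    rcases h0 with h | h
    · exact ⟨b, ⟨hab, le_rfl⟩, by simp [h]⟩
    · exact ⟨a, ⟨le_rfl, hab⟩, by simp [h]⟩
  set W : ℝ → ℝ := fun t => -k * Real.tan (k * (t - c)) * ‖u t‖ ^ 2 with hW
  have hcos : ∀ t ∈ Set.Icc a b, Real.cos (k * (t - c)) ≠ 0 := by
    intro t ht
    refine (Real.cos_pos_of_mem_Ioo (abs_lt.1 ?_)).ne'
    rw [abs_mul, abs_of_nonneg hk]
    refine lt_of_le_of_lt ?_ hkL
    gcongr
    rw [abs_le]
    constructor <;> linarith [ht.1, ht.2, hc.1, hc.2]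
  have hWd : ∀ t ∈ Set.Icc a b, HasDerivAt W
      ((-k * (1 / Real.cos (k * (t - c)) ^ 2 * k)) * ‖u t‖ ^ 2 +
        -k * Real.tan (k * (t - c)) * (2 * inner ℝ (u t) (u' t))) t := by
    intro t ht
    have h1 : HasDerivAt (fun t => k * (t - c)) k t := by
      simpa using ((hasDerivAt_id t).sub_const c).const_mul k
    exact (((Real.hasDerivAt_tan (hcos t ht)).comp t h1).const_mul (-k)).mul (hu t).norm_sq
  have hint : ∀ v : ℝ → ℂ, Continuous v → IntervalIntegrable (fun t => ‖v t‖ ^ 2) volume a b :=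
    fun v hv => (hv.norm.pow 2).intervalIntegrable _ _
  have key := intervalIntegral.sub_le_integral_of_hasDeriv_right_of_le (g := W) hab
    (φ := fun t => ‖u' t‖ ^ 2 - k ^ 2 * ‖u t‖ ^ 2)
    (fun t ht => (hWd t ht).continuousAt.continuousWithinAt)
    (fun t ht => (hWd t (Set.Ioo_subset_Icc_self ht)).hasDerivWithinAt)
    (((hu'.norm.pow 2).sub ((huc.norm.pow 2).const_mul _)).integrableOn_Icc)
    (fun t ht => by
      have h2 : 1 / Real.cos (k * (t - c)) ^ 2 = 1 + Real.tan (k * (t - c)) ^ 2 := by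
        have := hcos t (Set.Ioo_subset_Icc_self ht)
        rw [Real.tan_eq_sin_div_cos]
        field_simp
        rw [add_comm, Real.sin_sq_add_cos_sq]
      rw [h2]
      set φ := -k * Real.tan (k * (t - c)) with hφ
      have h3 : 0 ≤ ‖u' t - φ • u t‖ ^ 2 := by positivity
      rw [norm_sub_sq_real, inner_smul_right, norm_smul, mul_pow, Real.norm_eq_abs, sq_abs,
        real_inner_comm] at h3
      have h4 : φ ^ 2 = k ^ 2 * Real.tan (k * (t - c)) ^ 2 := by rw [hφ]; ring
      nlinarith)
  have : W b - W a = 0 := hcW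
  rw [this, intervalIntegral.integral_sub (hint _ hu') ((hint _ huc).const_mul _),
    intervalIntegral.integral_const_mul] at key
  linarith

theorem integral_norm_sq_le_of_eq_zero {u u' : ℝ → ℂ} (hu : ∀ t, HasDerivAt u (u' t) t)
    (hu' : Continuous u') {a b : ℝ} (hab : a ≤ b) (h0 : u a = 0 ∨ u b = 0) :
    ∫ t in a..b, ‖u t‖ ^ 2 ≤ (2 * (b - a) / Real.pi) ^ 2 * ∫ t in a..b, ‖u' t‖ ^ 2 := by
  rcases hab.eq_or_lt with rfl | hlt
  · simp
  have hL : 0 < b - a := sub_pos.2 hlt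
  have hpi := Real.pi_pos
  set K := Real.pi / (2 * (b - a)) with hK
  have hK0 : 0 < K := by positivity
  have h : K ^ 2 * ∫ t in a..b, ‖u t‖ ^ 2 ≤ ∫ t in a..b, ‖u' t‖ ^ 2 := by
    -- The sharp constant `K = π / (2(b - a))` is just out of reach of the strict inequality, hence
    -- the limit from below.
    have hc : Tendsto (fun k : ℝ => k ^ 2 * ∫ t in a..b, ‖u t‖ ^ 2) (𝓝[<] K)
        (𝓝 (K ^ 2 * ∫ t in a..b, ‖u t‖ ^ 2)) :=
      ((continuous_pow 2).mul continuous_const).continuousAt.tendsto.mono_left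
        nhdsWithin_le_nhds
    refine le_of_tendsto hc ?_
    filter_upwards [Ioo_mem_nhdsLT hK0] with k hk
    refine sq_mul_integral_norm_sq_le hu hu' hab hk.1.le ?_ h0
    calc k * (b - a) < K * (b - a) := by gcongr; exact hk.2
      _ = Real.pi / 2 := by rw [hK]; field_simp
  have h2 : (2 * (b - a) / Real.pi) ^ 2 * K ^ 2 = 1 := by rw [hK]; field_simp
  calc _ = (2 * (b - a) / Real.pi) ^ 2 * (K ^ 2 * ∫ t in a..b, ‖u t‖ ^ 2) := by
        rw [← mul_assoc, h2, one_mul]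
    _ ≤ _ := by gcongr

/-- Wirtinger's inequality. -/
theorem integral_norm_sub_sq_le {u u' : ℝ → ℂ} (hu : ∀ t, HasDerivAt u (u' t) t)
    (hu' : Continuous u') {a b c : ℝ} (hc : c ∈ Set.Icc a b) :
    ∫ t in a..b, ‖u t - u c‖ ^ 2 ≤ (2 * (b - a) / Real.pi) ^ 2 * ∫ t in a..b, ‖u' t‖ ^ 2 := by
  have hd : ∀ t, HasDerivAt (fun t => u t - u c) (u' t) t := fun t => (hu t).sub_const _
  have huc : Continuous fun t => u t - u c :=
    continuous_iff_continuousAt.2 fun t => (hd t).continuousAt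
  have hint : ∀ v : ℝ → ℂ, Continuous v → ∀ p q, IntervalIntegrable (fun t => ‖v t‖ ^ 2) volume p q :=
    fun v hv _ _ => (hv.norm.pow 2).intervalIntegrable _ _
  have h1 := integral_norm_sq_le_of_eq_zero hd hu' hc.1 (Or.inr (sub_self _))
  have h2 := integral_norm_sq_le_of_eq_zero hd hu' hc.2 (Or.inl (sub_self _))
  rw [← intervalIntegral.integral_add_adjacent_intervals (hint _ huc a c) (hint _ huc c b),
    ← intervalIntegral.integral_add_adjacent_intervals (hint _ hu' a c) (hint _ hu' c b), mul_add]
  have hpi := Real.pi_pos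
  have p1 : 0 ≤ c - a := sub_nonneg.2 hc.1
  have p2 : 0 ≤ b - c := sub_nonneg.2 hc.2
  have i1 : 0 ≤ ∫ t in a..c, ‖u' t‖ ^ 2 :=
    intervalIntegral.integral_nonneg hc.1 fun _ _ => by positivity
  have i2 : 0 ≤ ∫ t in c..b, ‖u' t‖ ^ 2 :=
    intervalIntegral.integral_nonneg hc.2 fun _ _ => by positivity
  refine add_le_add (h1.trans ?_) (h2.trans ?_)
  · gcongr
    exact hc.2
  · gcongr
    exact hc.1

/-! ### Bandlimited functions: Bernstein's inequality and pointwise values. -/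

theorem norm_sq_eq_integral_norm_sq (f : Lp ℂ 2 (volume : Measure ℝ)) :
    ‖f‖ ^ 2 = ∫ t, ‖f t‖ ^ 2 := by
  have h : (inner ℂ f f : ℂ) = ((∫ t, ‖f t‖ ^ 2 : ℝ) : ℂ) := by
    rw [L2.inner_def, ← integral_complex_ofReal]
    refine integral_congr_ae (ae_of_all _ fun t => ?_)
    simp only [inner_self_eq_norm_sq_to_K]
    push_cast
    rfl
  rw [inner_self_eq_norm_sq_to_K] at h
  exact Complex.ofReal_injective (by rw [← h]; push_cast; rfl)

theorem abs_le_bandRadius {Ω : Set ℝ} (hΩ : IsCompact Ω) {ω : ℝ} (hω : ω ∈ Ω) :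
    |ω| ≤ bandRadius Ω :=
  le_csSup (hΩ.image continuous_abs).bddAbove ⟨ω, hω, rfl⟩

theorem bandRadius_nonneg (Ω : Set ℝ) : 0 ≤ bandRadius Ω := by
  refine Real.sSup_nonneg ?_
  rintro _ ⟨ω, -, rfl⟩
  exact abs_nonneg ω

/-- Bernstein's inequality: differentiation acts on `B(Ω)` with norm at most `m_Ω`. -/
theorem exists_deriv_mem_bandlimited {Ω : Set ℝ} (hΩ : IsCompact Ω)
    {f : Lp ℂ 2 (volume : Measure ℝ)} (hf : f ∈ bandlimited Ω) :
    ∃ g ∈ bandlimited Ω, ‖g‖ ≤ bandRadius Ω * ‖f‖ ∧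
      ∀ t, HasDerivAt (pointValue f) (pointValue g t) t := by
  set F : Lp ℂ 2 (volume : Measure ℝ) := 𝓕 f with hF
  have hf' : ∀ᵐ ξ : ℝ, 2 * Real.pi * ξ ∉ Ω → F ξ = 0 := hf
  -- Differentiation is multiplication by `2πiξ`, of modulus at most `m_Ω` where `F` is nonzero;
  -- Plancherel then gives the norm bound.
  set G : ℝ → ℂ := fun ξ => (2 * Real.pi * Complex.I * ξ) * F ξ with hG
  have hpi := Real.pi_pos
  have hbound : ∀ᵐ ξ : ℝ, ‖G ξ‖ ≤ bandRadius Ω * ‖F ξ‖ := by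
    filter_upwards [hf'] with ξ h
    by_cases hξ : 2 * Real.pi * ξ ∈ Ω
    · have h1 := abs_le_bandRadius hΩ hξ
      rw [hG, norm_mul]
      gcongr
      refine le_of_eq_of_le ?_ h1
      simp [abs_mul, abs_of_pos hpi]
    · simp [hG, h hξ]
  have hGm : AEStronglyMeasurable G volume :=
    (by fun_prop : Continuous fun ξ : ℝ => (2 * Real.pi * Complex.I * ξ : ℂ)).aestronglyMeasurable.mul
      (Lp.aestronglyMeasurable F)
  have hGp : MemLp G 2 volume := (Lp.memLp F).of_le_mul hGm hbound
  set g : Lp ℂ 2 (volume : Measure ℝ) := 𝓕⁻ (hGp.toLp G) with hg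
  have hFg : (𝓕 g : Lp ℂ 2 (volume : Measure ℝ)) = hGp.toLp G :=
    FourierInvPair.fourier_fourierInv_eq _
  have hgG : ((𝓕 g : Lp ℂ 2 (volume : Measure ℝ)) : ℝ → ℂ) =ᵐ[volume] G := by
    rw [hFg]; exact hGp.coeFn_toLp
  have hgΩ : g ∈ bandlimited Ω := by
    change ∀ᵐ ξ : ℝ, 2 * Real.pi * ξ ∉ Ω → (𝓕 g : Lp ℂ 2 (volume : Measure ℝ)) ξ = 0
    filter_upwards [hf', hgG] with ξ h1 h2 h3
    rw [h2, hG]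
    simp [h1 h3]
  refine ⟨g, hgΩ, ?_, ?_⟩
  · rw [← Lp.norm_fourier_eq g, ← Lp.norm_fourier_eq f]
    refine Lp.norm_le_mul_norm_of_ae_le_mul ?_
    filter_upwards [hgG, hbound] with ξ h1 h2
    rw [h1]
    exact h2
  · intro t
    have hFi := integrable_fourier_of_mem_bandlimited hΩ hf
    have hGi : Integrable G := (integrable_fourier_of_mem_bandlimited hΩ hgΩ).congr hgG
    have hxF : Integrable fun ξ : ℝ => ξ • F ξ := by
      refine (hGi.const_mul (2 * Real.pi * Complex.I)⁻¹).congr (ae_of_all _ fun ξ => ?_)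
      have : (2 * Real.pi * Complex.I : ℂ) ≠ 0 := Complex.two_pi_I_ne_zero
      simp only [hG, Complex.real_smul]
      field_simp
    have h1 := (Real.hasDerivAt_fourier hFi hxF (-t)).scomp t (hasDerivAt_neg t)
    have e1 : (𝓕 (F : ℝ → ℂ)) ∘ Neg.neg = pointValue f := by
      funext u
      simp only [Function.comp, pointValue, ← hF, Real.fourierInv_eq_fourier_neg]
    rw [e1] at h1
    convert! h1 using 1
    simp only [pointValue, Real.fourierInv_eq_fourier_neg, neg_smul, one_smul, Real.fourier_eq]
    rw [← integral_neg]
    refine integral_congr_ae ?_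
    filter_upwards [hgG] with ξ h
    rw [h, hG, ← smul_neg]
    congr 1
    simp only [smul_eq_mul]
    ring

theorem exists_iterated_derivs {Ω : Set ℝ} (hΩ : IsCompact Ω)
    {f : Lp ℂ 2 (volume : Measure ℝ)} (hf : f ∈ bandlimited Ω) :
    ∃ D : ℕ → Lp ℂ 2 (volume : Measure ℝ), D 0 = f ∧ (∀ k, D k ∈ bandlimited Ω) ∧
      (∀ k, ‖D k‖ ≤ bandRadius Ω ^ k * ‖f‖) ∧
      ∀ k t, HasDerivAt (pointValue (D k)) (pointValue (D (k + 1)) t) t := by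
  choose d hd using fun g : bandlimited Ω => exists_deriv_mem_bandlimited hΩ g.2
  let E : ℕ → bandlimited Ω := fun k => (fun g => ⟨d g, (hd g).1⟩)^[k] ⟨f, hf⟩
  have hE : ∀ k, (E (k + 1) : Lp ℂ 2 (volume : Measure ℝ)) = d (E k) := fun k => by
    simp only [E, Function.iterate_succ_apply']
  refine ⟨fun k => E k, rfl, fun k => (E k).2, fun k => ?_, fun k t => ?_⟩
  · induction k with
    | zero => simp [E]
    | succ k ih =>
      change ‖(E (k + 1) : Lp ℂ 2 (volume : Measure ℝ))‖ ≤ _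
      rw [hE]
      refine ((hd (E k)).2.1).trans ?_
      rw [pow_succ', mul_assoc]
      exact mul_le_mul_of_nonneg_left ih (bandRadius_nonneg Ω)
  · change HasDerivAt _ (pointValue (E (k + 1) : Lp ℂ 2 (volume : Measure ℝ)) t) t
    rw [hE]
    exact (hd (E k)).2.2 t

theorem norm_sq_eq_integral_pointValue {Ω : Set ℝ} (hΩ : IsCompact Ω)
    {f : Lp ℂ 2 (volume : Measure ℝ)} (hf : f ∈ bandlimited Ω) :
    ‖f‖ ^ 2 = ∫ t, ‖pointValue f t‖ ^ 2 := by
  rw [norm_sq_eq_integral_norm_sq]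
  refine integral_congr_ae ?_
  filter_upwards [pointValue_ae_eq hΩ hf] with t h
  rw [h]

theorem integrable_norm_sq_pointValue {Ω : Set ℝ} (hΩ : IsCompact Ω)
    {f : Lp ℂ 2 (volume : Measure ℝ)} (hf : f ∈ bandlimited Ω) :
    Integrable fun t => ‖pointValue f t‖ ^ 2 := by
  have h := (Lp.memLp f).integrable_norm_pow (by norm_num)
  refine h.congr ?_
  filter_upwards [pointValue_ae_eq hΩ hf] with t h
  rw [h]

/-- Continuous functions that agree almost everywhere agree everywhere. -/
theorem pointValue_add {Ω : Set ℝ} (hΩ : IsCompact Ω) {f g : Lp ℂ 2 (volume : Measure ℝ)}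
    (hf : f ∈ bandlimited Ω) (hg : g ∈ bandlimited Ω) :
    pointValue (f + g) = pointValue f + pointValue g :=
  (continuous_pointValue hΩ (Submodule.add_mem _ hf hg)).ae_eq_iff_eq volume
    ((continuous_pointValue hΩ hf).add (continuous_pointValue hΩ hg)) |>.1 <| by
    filter_upwards [pointValue_ae_eq hΩ (Submodule.add_mem _ hf hg), pointValue_ae_eq hΩ hf,
      pointValue_ae_eq hΩ hg, Lp.coeFn_add f g] with t h1 h2 h3 h4
    rw [h1, h4, Pi.add_apply, Pi.add_apply, h2, h3]

theorem pointValue_smul {Ω : Set ℝ} (hΩ : IsCompact Ω) (c : ℂ)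
    {f : Lp ℂ 2 (volume : Measure ℝ)} (hf : f ∈ bandlimited Ω) :
    pointValue (c • f) = c • pointValue f :=
  (continuous_pointValue hΩ (Submodule.smul_mem _ c hf)).ae_eq_iff_eq volume
    ((continuous_pointValue hΩ hf).const_smul c) |>.1 <| by
    filter_upwards [pointValue_ae_eq hΩ (Submodule.smul_mem _ c hf), pointValue_ae_eq hΩ hf,
      Lp.coeFn_smul c f] with t h1 h2 h4
    rw [h1, h4, Pi.smul_apply, Pi.smul_apply, h2]

/-- Here `Ω ⊆ {0}` is a null set. This degenerate case is split off because the weights used later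
must be positive. -/
theorem eq_zero_of_bandRadius_eq_zero {Ω : Set ℝ} (hΩ : IsCompact Ω) (h0 : bandRadius Ω = 0)
    {f : Lp ℂ 2 (volume : Measure ℝ)} (hf : f ∈ bandlimited Ω) : f = 0 := by
  have hf' : ∀ᵐ ξ : ℝ, 2 * Real.pi * ξ ∉ Ω → (𝓕 f : Lp ℂ 2 (volume : Measure ℝ)) ξ = 0 := hf
  have h1 : (𝓕 f : Lp ℂ 2 (volume : Measure ℝ)) = 0 := by
    refine Lp.ext ?_
    filter_upwards [hf', Lp.coeFn_zero ℂ 2 (volume : Measure ℝ),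
      Measure.ae_ne volume (0 : ℝ)] with ξ h2 h3 h4
    rw [h3, h2, Pi.zero_apply]
    intro hξ
    have h5 := abs_le_bandRadius hΩ hξ
    rw [h0] at h5
    have h6 := abs_nonpos_iff.1 h5
    simp [Real.pi_ne_zero, h4] at h6
  rw [← norm_eq_zero, ← Lp.norm_fourier_eq f, h1, norm_zero]

/-! ### Geometry of the Voronoi cells. -/

theorem isClosed_voronoi {I : Type*} (y : I → ℝ) (n : I) : IsClosed (voronoi y n) := by
  have : voronoi y n = ⋂ k, {t | |t - y n| ≤ |t - y k|} := by
    ext t; simp [voronoi]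
  rw [this]
  exact isClosed_iInter fun k => isClosed_le (by fun_prop) (by fun_prop)

/-- After squaring, each defining inequality is affine in `t`, so it cuts out a half-line or
everything. -/
theorem ordConnected_voronoi {I : Type*} (y : I → ℝ) (n : I) : (voronoi y n).OrdConnected := by
  refine ⟨fun p hp q hq t ht k => ?_⟩
  have h1 := sq_le_sq.2 (hp k)
  have h2 := sq_le_sq.2 (hq k)
  refine sq_le_sq.1 ?_
  rcases le_total (y n) (y k) with h | h
  · nlinarith [mul_nonneg (sub_nonneg.2 h) (sub_nonneg.2 ht.2)]
  · nlinarith [mul_nonneg (sub_nonneg.2 h) (sub_nonneg.2 ht.1)]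

theorem self_mem_voronoi {I : Type*} (y : I → ℝ) (n : I) : y n ∈ voronoi y n := fun k => by
  simp

theorem aedisjoint_voronoi {I : Type*} {y : I → ℝ} (hy : Function.Injective y) :
    Pairwise (Function.onFun (AEDisjoint volume) (voronoi y)) := by
  intro n k hnk
  refine measure_mono_null (t := {(y n + y k) / 2}) ?_ Real.volume_singleton
  rintro t ⟨h1, h2⟩
  have h := le_antisymm (h1 k) (h2 n)
  have hne : y n ≠ y k := fun h => hnk (hy h)
  rw [Set.mem_singleton_iff]
  rcases abs_eq_abs.1 h with h | h
  · exact absurd (by linarith) hne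
  · linarith

namespace IsBunchedSamplingSet

variable {I : Type*} {s : ℕ} {x : I → Fin (s + 1) → ℝ} {δ τ : ℝ}

theorem countable (hx : IsBunchedSamplingSet s x δ τ) : Countable I := by
  have h : (Set.univ : Set I) = ⋃ N : ℕ, {n | |x n 0| ≤ N} := by
    ext n
    simpa using exists_nat_ge |x n 0|
  rw [← Set.countable_univ_iff, h]
  exact Set.countable_iUnion fun N => (hx.centres_locallyFinite N).countable

theorem iUnion_voronoi (hx : IsBunchedSamplingSet s x δ τ) :
    ⋃ n, voronoi (fun k => x k 0) n = Set.univ := by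
  refine Set.eq_univ_of_forall fun t => Set.mem_iUnion.2 ?_
  obtain ⟨n₀⟩ := hx.nonempty
  have hself : |x n₀ 0| ≤ |t| + |t - x n₀ 0| := by
    have := abs_sub t (t - x n₀ 0)
    simpa using this
  -- A centre outside this finite set is farther from `t` than `x n₀ 0`, so the nearest centre
  -- exists and lies in it.
  obtain ⟨n, hn, hmin⟩ := Set.exists_min_image {n | |x n 0| ≤ |t| + |t - x n₀ 0|}
    (fun n => |t - x n 0|) (hx.centres_locallyFinite _) ⟨n₀, hself⟩
  refine ⟨n, fun k => ?_⟩
  by_cases hk : |x k 0| ≤ |t| + |t - x n₀ 0|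
  · exact hmin k hk
  · have h1 := hmin n₀ hself
    have h2 := abs_sub t (t - x k 0)
    rw [sub_sub_cancel] at h2
    change |t - x n 0| ≤ |t - x k 0|
    push Not at hk
    linarith

theorem abs_sub_le_density (hx : IsBunchedSamplingSet s x δ τ) {n : I} {t : ℝ}
    (ht : t ∈ voronoi (fun k => x k 0) n) : |t - x n 0| ≤ δ := by
  have := hx.nonempty
  exact (le_ciInf ht).trans (hx.density.1 ⟨t, rfl⟩)

theorem exists_voronoi_eq_Icc (hx : IsBunchedSamplingSet s x δ τ) (n : I) :
    ∃ a b : ℝ, voronoi (fun k => x k 0) n = Set.Icc a b ∧ x n 0 ∈ Set.Icc a b ∧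
      x n 0 - a ≤ δ ∧ b - x n 0 ≤ δ := by
  have hsub : voronoi (fun k => x k 0) n ⊆ Set.Icc (x n 0 - δ) (x n 0 + δ) := fun t ht => by
    have := abs_le.1 (hx.abs_sub_le_density ht)
    constructor <;> linarith
  have hne : (voronoi (fun k => x k 0) n).Nonempty := ⟨x n 0, self_mem_voronoi _ n⟩
  have hcomp := isCompact_Icc.of_isClosed_subset (isClosed_voronoi _ n) hsub
  have hconn : IsConnected (voronoi (fun k => x k 0) n) :=
    ⟨hne, isPreconnected_iff_ordConnected.2 (ordConnected_voronoi _ n)⟩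
  have heq := eq_Icc_of_connected_compact hconn hcomp
  have hself := self_mem_voronoi (fun k => x k 0) n
  refine ⟨_, _, heq, heq ▸ hself, ?_, ?_⟩
  · linarith [(hsub (hcomp.sInf_mem hne)).1]
  · linarith [(hsub (hcomp.sSup_mem hne)).2]

/-- Otherwise every cell lies in a single point, and countably many of them would cover the line. -/
theorem density_pos (hx : IsBunchedSamplingSet s x δ τ) : 0 < δ := by
  by_contra! hδ
  have := hx.countable
  have h : ∀ n, voronoi (fun k => x k 0) n ⊆ {x n 0} := fun n t ht => by
    have := (hx.abs_sub_le_density ht).trans hδ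
    simpa [sub_eq_zero] using this
  have h2 : (Set.univ : Set ℝ).Countable := by
    rw [← hx.iUnion_voronoi]
    exact Set.countable_iUnion fun n => (Set.countable_singleton _).mono (h n)
  exact Cardinal.not_countable_real h2

theorem mem_voronoi (hx : IsBunchedSamplingSet s x δ τ) (n : I) (m : Fin (s + 1)) :
    x n m ∈ voronoi (fun k => x k 0) n := by
  obtain ⟨h, -, h1, h2, -⟩ := hx.bunches
  exact h1 n (h2 n m)

theorem abs_node_sub_le (hx : IsBunchedSamplingSet s x δ τ) (n : I) (m : Fin (s + 1)) :
    |x n m - x n 0| ≤ τ * δ := by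
  obtain ⟨h, -, -, h2, h3⟩ := hx.bunches
  have h4 := h2 n m
  have h5 : h n ≤ τ * δ := h3.1 ⟨n, rfl⟩
  rw [abs_le]
  constructor <;> linarith [h4.1, h4.2]

theorem hasSum_integral_voronoi (hx : IsBunchedSamplingSet s x δ τ) {φ : ℝ → ℝ}
    (hφ : Integrable φ) :
    HasSum (fun n => ∫ t in voronoi (fun k => x k 0) n, φ t) (∫ t, φ t) := by
  have := hx.countable
  have h := hasSum_integral_iUnion_ae (μ := volume) (f := φ)
    (fun n => (isClosed_voronoi (fun k => x k 0) n).measurableSet.nullMeasurableSet)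
    (aedisjoint_voronoi hx.centres_injective) hφ.integrableOn
  rwa [hx.iUnion_voronoi, setIntegral_univ] at h

end IsBunchedSamplingSet

/-! ### The function `h̃`, its inverse at `1`, and Stirling estimates. -/

theorem hTilde_nonneg {s : ℕ} {τ z : ℝ} (hτ : 0 ≤ τ) (hz : 0 ≤ z) : 0 ≤ hTilde s τ z := by
  have := Real.pi_pos
  unfold hTilde
  positivity

theorem hTilde_pos {s : ℕ} {τ z : ℝ} (hτ : 0 ≤ τ) (hz : 0 < z) : 0 < hTilde s τ z := by
  have := Real.pi_pos
  unfold hTilde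
  positivity

theorem hTilde_strictMonoOn (s : ℕ) {τ : ℝ} (hτ : 0 ≤ τ) :
    StrictMonoOn (hTilde s τ) (Set.Ici 0) := by
  intro a ha b hb hab
  have := Real.pi_pos
  have ha' : 0 ≤ a := ha
  have hb' : 0 < b := ha'.trans_lt hab
  unfold hTilde
  refine mul_lt_mul'' ?_ ?_ (by positivity) (by positivity) <;> gcongr

theorem continuous_hTilde (s : ℕ) (τ : ℝ) : Continuous (hTilde s τ) := by
  unfold hTilde
  fun_prop

theorem exists_hTilde_eq_one (s : ℕ) {τ : ℝ} (hτ : 0 ≤ τ) :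
    ∃ z ∈ Set.Ioi (0 : ℝ), hTilde s τ z = 1 := by
  have hpi := Real.pi_pos
  have h0 : hTilde s τ 0 = 0 := by simp [hTilde]
  set Z : ℝ := ((s + 1).factorial : ℝ) with hZ
  have hZ1 : 1 ≤ Z := Nat.one_le_cast.2 (Nat.factorial_pos (s + 1))
  have h1 : 1 ≤ hTilde s τ Z := by
    have hp : 1 ≤ (1 + τ) ^ s := one_le_pow₀ (by linarith)
    have hq : Z ≤ Z ^ (s + 1) := le_self_pow₀ hZ1 (by simp)
    calc (1 : ℝ) = 1 * Z / Z * 1 := by field_simp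
      _ ≤ hTilde s τ Z := by
        unfold hTilde
        rw [← hZ]
        gcongr
        have : 0 ≤ 4 * Z / Real.pi := by positivity
        linarith
  obtain ⟨z, hz, hz1⟩ := intermediate_value_Icc (zero_le_one.trans hZ1)
    (continuous_hTilde s τ).continuousOn ⟨h0.le.trans zero_le_one, h1⟩
  refine ⟨z, lt_of_le_of_ne hz.1 ?_, hz1⟩
  rintro rfl
  rw [h0] at hz1
  exact zero_ne_one hz1

theorem HTilde_one_pos (s : ℕ) {τ : ℝ} (hτ : 0 ≤ τ) : 0 < HTilde s τ 1 :=
  Function.invFunOn_mem (exists_hTilde_eq_one s hτ)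

theorem hTilde_HTilde_one (s : ℕ) {τ : ℝ} (hτ : 0 ≤ τ) : hTilde s τ (HTilde s τ 1) = 1 :=
  Function.invFunOn_eq (exists_hTilde_eq_one s hτ)

theorem hTilde_lt_one_iff (s : ℕ) {τ z : ℝ} (hτ : 0 ≤ τ) (hz : 0 ≤ z) :
    hTilde s τ z < 1 ↔ z < HTilde s τ 1 := by
  have h := (hTilde_strictMonoOn s hτ).lt_iff_lt hz (HTilde_one_pos s hτ).le
  rwa [hTilde_HTilde_one s hτ] at h

theorem one_lt_hTilde_iff (s : ℕ) {τ z : ℝ} (hτ : 0 ≤ τ) (hz : 0 ≤ z) :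
    1 < hTilde s τ z ↔ HTilde s τ 1 < z := by
  have h := (hTilde_strictMonoOn s hτ).lt_iff_lt (HTilde_one_pos s hτ).le hz
  rwa [hTilde_HTilde_one s hτ] at h

/-- Used as `4/(πe) < 1/2`, which simplifies the factor `1 + 4z/π` at the threshold to `1 +
(s+1)/2`. -/
theorem eight_lt_pi_mul_exp_one : 8 < Real.pi * Real.exp 1 := by
  nlinarith [Real.pi_gt_three, Real.exp_one_gt_d9]

theorem sqrt_mul_pow_div_factorial_le_one (n : ℕ) :
    √(2 * Real.pi * n) * ((n / Real.exp 1) ^ n / (n.factorial : ℝ)) ≤ 1 := by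
  rw [← mul_div_assoc, div_le_one (by positivity)]
  exact Stirling.le_factorial_stirling n

theorem pow_div_factorial_le_one (n : ℕ) (hn : n ≠ 0) :
    (n / Real.exp 1) ^ n / (n.factorial : ℝ) ≤ 1 := by
  refine le_trans ?_ (sqrt_mul_pow_div_factorial_le_one n)
  refine le_mul_of_one_le_left (by positivity) ?_
  rw [Real.one_le_sqrt]
  have : (1 : ℝ) ≤ n := by exact_mod_cast Nat.one_le_iff_ne_zero.2 hn
  nlinarith [Real.pi_gt_three]

/-- Measuring `z` in units of the threshold separates the exponential factor `c^(s+1)` from the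
Stirling quotient and the linear factor. -/
theorem hTilde_mul_div (s : ℕ) {τ : ℝ} (hτ : 0 ≤ τ) (c : ℝ) :
    hTilde s τ (c * (((s : ℝ) + 1) / ((1 + τ) * Real.exp 1))) =
      (1 + τ)⁻¹ * c ^ (s + 1) *
        ((((s + 1 : ℕ) : ℝ) / Real.exp 1) ^ (s + 1) / ((s + 1).factorial : ℝ)) *
        (1 + 4 * c * ((s : ℝ) + 1) / ((1 + τ) * (Real.pi * Real.exp 1))) := by
  have h1 : (1 + τ) ≠ 0 := by positivity
  have := Real.pi_ne_zero
  unfold hTilde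
  have h2 : c * (((s : ℝ) + 1) / ((1 + τ) * Real.exp 1)) =
      (1 + τ)⁻¹ * c * (((s + 1 : ℕ) : ℝ) / Real.exp 1) := by
    push_cast
    field_simp
  have h3 : (1 + τ) ^ s * (1 + τ)⁻¹ ^ (s + 1) = (1 + τ)⁻¹ := by
    rw [pow_succ, ← mul_assoc, ← mul_pow, mul_inv_cancel₀ h1, one_pow, one_mul]
  have h4 : 4 * (c * (((s : ℝ) + 1) / ((1 + τ) * Real.exp 1))) / Real.pi =
      4 * c * ((s : ℝ) + 1) / ((1 + τ) * (Real.pi * Real.exp 1)) := by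
    field_simp
  rw [h4, h2, mul_pow, mul_pow]
  congr 1
  linear_combination (c ^ (s + 1) * (((s + 1 : ℕ) : ℝ) / Real.exp 1) ^ (s + 1) /
    ((s + 1).factorial : ℝ)) * h3

theorem hTilde_mul_div_le (s : ℕ) {τ c : ℝ} (hτ : 0 ≤ τ) (hc : 0 ≤ c) (hc1 : c ≤ 1) :
    hTilde s τ (c * (((s : ℝ) + 1) / ((1 + τ) * Real.exp 1))) ≤
      c ^ (s + 1) *
        ((((s + 1 : ℕ) : ℝ) / Real.exp 1) ^ (s + 1) / ((s + 1).factorial : ℝ)) *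
        (1 + ((s : ℝ) + 1) / 2) := by
  rw [hTilde_mul_div s hτ]
  have hpe := eight_lt_pi_mul_exp_one
  have hle : 4 * c * ((s : ℝ) + 1) / ((1 + τ) * (Real.pi * Real.exp 1)) ≤ ((s : ℝ) + 1) / 2 := by
    rw [div_le_div_iff₀ (by positivity) (by norm_num)]
    have h2 : 8 ≤ (1 + τ) * (Real.pi * Real.exp 1) := by nlinarith
    have h3 : 4 * c * ((s : ℝ) + 1) ≤ 4 * ((s : ℝ) + 1) := by gcongr; linarith
    have h4 : ((s : ℝ) + 1) * 8 ≤ ((s : ℝ) + 1) * ((1 + τ) * (Real.pi * Real.exp 1)) := by gcongr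
    linarith
  gcongr
  exact mul_le_of_le_one_left (by positivity) (inv_le_one_of_one_le₀ (by linarith))

theorem eventually_pow_mul_lt_one {c : ℝ} (hc : 0 ≤ c) (hc1 : c < 1) :
    ∃ S : ℕ, ∀ s, S ≤ s → c ^ (s + 1) * (1 + ((s : ℝ) + 1) / 2) < 1 := by
  have h1 := tendsto_pow_atTop_nhds_zero_of_lt_one hc hc1
  have h2 := tendsto_self_mul_const_pow_of_lt_one hc hc1
  have h3 : Tendsto (fun n : ℕ => c ^ n + (n * c ^ n) / 2) atTop (𝓝 (0 + 0 / 2)) :=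
    h1.add (h2.div_const 2)
  rw [zero_div, add_zero] at h3
  obtain ⟨S, hS⟩ := eventually_atTop.1 (h3.eventually_lt_const zero_lt_one)
  refine ⟨S, fun s hs => ?_⟩
  have := hS (s + 1) (by omega)
  push_cast at this
  linarith

/-- Below a fixed fraction of the threshold, `h̃` is less than `1` uniformly in `τ`. -/
theorem exists_forall_hTilde_lt_one {c : ℝ} (hc : 0 ≤ c) (hc1 : c < 1) :
    ∃ S : ℕ, ∀ s, S ≤ s → ∀ τ : ℝ, 0 ≤ τ →
      hTilde s τ (c * (((s : ℝ) + 1) / ((1 + τ) * Real.exp 1))) < 1 := by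
  obtain ⟨S, hS⟩ := eventually_pow_mul_lt_one hc hc1
  refine ⟨S, fun s hs τ hτ => ((hTilde_mul_div_le s hτ hc hc1.le).trans ?_).trans_lt (hS s hs)⟩
  gcongr
  exact mul_le_of_le_one_right (by positivity) (pow_div_factorial_le_one (s + 1) (by simp))

/-- The Stirling quotient decays no faster than a multiple of `1/√(s+1)`, which `c^(s+1)` overcomes.
-/
theorem eventually_one_lt_hTilde {c τ : ℝ} (hc : 1 < c) (hτ : 0 ≤ τ) :
    ∀ᶠ s : ℕ in atTop, 1 < hTilde s τ (c * (((s : ℝ) + 1) / ((1 + τ) * Real.exp 1))) := by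
  obtain ⟨K, hK0, hK⟩ : ∃ K : ℝ, 0 < K ∧ ∀ n : ℕ,
      1 ≤ K * √(2 * ((n + 1 : ℕ) : ℝ)) *
        ((((n + 1 : ℕ) : ℝ) / Real.exp 1) ^ (n + 1) / ((n + 1).factorial : ℝ)) := by
    -- The Stirling sequence decreases from index `1`, so its first term bounds all the others.
    refine ⟨Stirling.stirlingSeq 1, Stirling.stirlingSeq'_pos 0, fun n => ?_⟩
    have h := Stirling.stirlingSeq'_antitone (Nat.zero_le n)
    simp only [Function.comp] at h
    have h2 : ((n + 1).factorial : ℝ) / (√(2 * ((n + 1 : ℕ) : ℝ)) *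
      (((n + 1 : ℕ) : ℝ) / Real.exp 1) ^ (n + 1)) ≤ Stirling.stirlingSeq 1 := h
    rw [div_le_iff₀ (by positivity)] at h2
    rw [← mul_div_assoc, one_le_div (by positivity)]
    linarith
  have hpi := Real.pi_pos
  have hlim : Tendsto (fun n : ℕ => (2 * K * (1 + τ) * n) * c⁻¹ ^ n) atTop (𝓝 0) := by
    have := (tendsto_self_mul_const_pow_of_lt_one (r := c⁻¹) (by positivity)
      (inv_lt_one_of_one_lt₀ hc)).const_mul (2 * K * (1 + τ))
    simpa [mul_assoc] using this
  have hlim' := hlim.comp (tendsto_add_atTop_nat 1)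
  filter_upwards [hlim'.eventually_lt_const zero_lt_one] with s hs
  simp only [Function.comp] at hs
  rw [inv_pow, ← div_eq_mul_inv, div_lt_one (by positivity)] at hs
  rw [hTilde_mul_div s hτ]
  set R := (((s + 1 : ℕ) : ℝ) / Real.exp 1) ^ (s + 1) / ((s + 1).factorial : ℝ) with hR
  have hR0 : 0 < R := by positivity
  have hsq : √(2 * ((s + 1 : ℕ) : ℝ)) ≤ 2 * ((s + 1 : ℕ) : ℝ) := by
    rw [Real.sqrt_le_left (by positivity)]
    push_cast
    nlinarith [(Nat.cast_nonneg s : (0 : ℝ) ≤ s)]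
  have h1 : 1 ≤ K * (2 * ((s + 1 : ℕ) : ℝ)) * R := (hK s).trans (by gcongr)
  have h2 : 1 < (1 + τ)⁻¹ * c ^ (s + 1) * R := by
    refine h1.trans_lt ?_
    refine mul_lt_mul_of_pos_right ?_ hR0
    rw [inv_mul_eq_div, lt_div_iff₀ (by positivity)]
    linarith
  refine h2.trans_le (le_mul_of_one_le_right (zero_le_one.trans h2.le) ?_)
  have : 0 ≤ 4 * c * ((s : ℝ) + 1) / ((1 + τ) * (Real.pi * Real.exp 1)) := by positivity
  linarith

theorem HTilde_one_isEquivalent {τ : ℝ} (hτ : 0 ≤ τ) :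
    Asymptotics.IsEquivalent atTop (fun s : ℕ => HTilde s τ 1)
      (fun s : ℕ => ((s : ℝ) + 1) / ((1 + τ) * Real.exp 1)) := by
  have hr : ∀ s : ℕ, 0 < ((s : ℝ) + 1) / ((1 + τ) * Real.exp 1) := fun s => by positivity
  refine Asymptotics.isEquivalent_of_tendsto_one ?_
  rw [tendsto_order]
  constructor
  · intro a ha
    -- The order criterion allows negative `a`, while the estimate on `h̃` needs a nonnegative
    -- fraction.
    have hc : max a 0 < 1 := max_lt ha one_pos
    obtain ⟨S, hS⟩ := exists_forall_hTilde_lt_one (le_max_right a 0) hc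
    filter_upwards [eventually_ge_atTop S] with s hs
    have h := (hTilde_lt_one_iff s hτ (mul_nonneg (le_max_right a 0) (hr s).le)).1 (hS s hs τ hτ)
    rw [Pi.div_apply, lt_div_iff₀ (hr s)]
    exact (mul_le_mul_of_nonneg_right (le_max_left a 0) (hr s).le).trans_lt h
  · intro a ha
    filter_upwards [eventually_one_lt_hTilde ha hτ] with s hs
    rw [Pi.div_apply, div_lt_iff₀ (hr s)]
    exact (one_lt_hTilde_iff s hτ (mul_nonneg (zero_le_one.trans ha.le) (hr s).le)).1 hs

/-- With `N = s + 1`, Stirling bounds `h̃` below the threshold by `(1+τ)⁻¹ (1 + N/2) / √(2πN)`. The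
prefactor is at most `(1+τ)/√(2s+1)`, and `1 + N/2 < √(2πN (2s+1))` for every `s`. -/
theorem sqrt_mul_hTilde_lt_one {s : ℕ} {τ z : ℝ} (hτ : 0 ≤ τ) (hz : 0 ≤ z)
    (hlt : z < ((s : ℝ) + 1) / ((1 + τ) * Real.exp 1)) :
    √((1 + τ) / (2 * s + 1)) * hTilde s τ z < 1 := by
  have hpi := Real.pi_gt_three
  have hpe := eight_lt_pi_mul_exp_one
  set N : ℝ := ((s + 1 : ℕ) : ℝ) with hN
  have hNs : N = s + 1 := by rw [hN]; push_cast; ring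
  have hs0 : (0 : ℝ) ≤ s := Nat.cast_nonneg s
  have hτ1 : 0 < 1 + τ := by positivity
  set R := (N / Real.exp 1) ^ (s + 1) / ((s + 1).factorial : ℝ) with hR
  have hR0 : 0 < R := by positivity
  have hRle : √(2 * Real.pi * N) * R ≤ 1 := sqrt_mul_pow_div_factorial_le_one (s + 1)
  have h1 : hTilde s τ z ≤ (1 + τ)⁻¹ * R * (1 + N / 2) := by
    have h2 := ((hTilde_strictMonoOn s hτ).lt_iff_lt hz (Set.mem_Ici.2 (hz.trans hlt.le))).2 hlt
    have h3 := hTilde_mul_div s hτ 1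
    rw [one_mul] at h3
    rw [h3] at h2
    refine h2.le.trans ?_
    rw [one_pow, mul_one, mul_one, ← hN, ← hNs]
    refine mul_le_mul_of_nonneg_left (add_le_add le_rfl ?_) (by positivity)
    rw [div_le_div_iff₀ (by positivity) (by norm_num)]
    have h2 : 8 ≤ (1 + τ) * (Real.pi * Real.exp 1) := by nlinarith
    have h4 : N * 8 ≤ N * ((1 + τ) * (Real.pi * Real.exp 1)) := by gcongr
    linarith
  have h0 := hTilde_nonneg (s := s) hτ hz
  have hq : √((1 + τ) / (2 * s + 1)) ≤ (1 + τ) / √(2 * s + 1) := by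
    rw [Real.sqrt_div hτ1.le]
    gcongr
    rw [Real.sqrt_le_left hτ1.le]
    nlinarith
  have hN2 : 1 + N / 2 < √(2 * Real.pi * N) * √(2 * s + 1) := by
    rw [← Real.sqrt_mul (by positivity)]
    refine Real.lt_sqrt_of_sq_lt ?_
    rw [hNs]
    nlinarith [mul_nonneg hs0 hs0, mul_pos (show (0 : ℝ) < s + 1 by linarith)
      (show (0 : ℝ) < 2 * s + 1 by linarith)]
  calc _ ≤ (1 + τ) / √(2 * s + 1) * ((1 + τ)⁻¹ * R * (1 + N / 2)) := by gcongr
    _ = R * (1 + N / 2) / √(2 * s + 1) := by field_simp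
    _ < R * (√(2 * Real.pi * N) * √(2 * s + 1)) / √(2 * s + 1) := by gcongr
    _ = √(2 * Real.pi * N) * R := by field_simp
    _ ≤ 1 := hRle

/-! ### The `L²` error of interpolation, on one cell and globally. -/

/-- A sharp form of `‖v + w‖² ≤ (1 + θ) ‖v‖² + (1 + θ⁻¹) ‖w‖²`. -/
theorem norm_add_sq_le {θ : ℝ} (hθ : 0 < θ) (v w : ℂ) :
    ‖v + w‖ ^ 2 ≤ (1 + θ) * ‖v‖ ^ 2 + (1 + θ⁻¹) * ‖w‖ ^ 2 := by
  have h1 : ‖v + w‖ ^ 2 ≤ (‖v‖ + ‖w‖) ^ 2 := by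
    gcongr
    exact norm_add_le v w
  have h2 : (1 + θ) * ‖v‖ ^ 2 + (1 + θ⁻¹) * ‖w‖ ^ 2 - (‖v‖ + ‖w‖) ^ 2 =
      θ⁻¹ * (θ * ‖v‖ - ‖w‖) ^ 2 := by
    field_simp
    ring
  have h3 : 0 ≤ θ⁻¹ * (θ * ‖v‖ - ‖w‖) ^ 2 := by positivity
  linarith

/-- Only `u²` is estimated crudely; the power `2s` is integrated, which produces `1/(2s+1)`. One
factor `c` is kept so that the two sides of a cell add up to its length. -/
theorem integral_pow_mul_le {δ τ c : ℝ} (s : ℕ) (hτ : 0 ≤ τ) (hc : 0 ≤ c) (hcδ : c ≤ δ) :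
    ∫ u in (0 : ℝ)..c, u ^ 2 * (u + τ * δ) ^ (2 * s) ≤
      c * (δ ^ (2 * s + 2) * (1 + τ) ^ (2 * s + 1) / (2 * s + 1)) := by
  have hδ : 0 ≤ δ := hc.trans hcδ
  calc ∫ u in (0 : ℝ)..c, u ^ 2 * (u + τ * δ) ^ (2 * s)
      ≤ ∫ u in (0 : ℝ)..c, c ^ 2 * (u + τ * δ) ^ (2 * s) := by
        refine intervalIntegral.integral_mono_on hc
          ((by fun_prop : Continuous _).intervalIntegrable _ _)
          ((by fun_prop : Continuous _).intervalIntegrable _ _) fun u hu => ?_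
        have h1 : 0 ≤ (u + τ * δ) ^ (2 * s) := (even_two_mul s).pow_nonneg _
        have := hu.1
        have := hu.2
        gcongr
    _ = c ^ 2 * (((c + τ * δ) ^ (2 * s + 1) - (0 + τ * δ) ^ (2 * s + 1)) / (2 * s + 1)) := by
        rw [intervalIntegral.integral_const_mul,
          intervalIntegral.integral_comp_add_right (fun v => v ^ (2 * s)), integral_pow]
        push_cast
        rfl
    _ ≤ (c * δ) * ((δ + τ * δ) ^ (2 * s + 1) / (2 * s + 1)) := by
        have h2 : 0 ≤ (0 + τ * δ) ^ (2 * s + 1) := by positivity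
        have h3 : (c + τ * δ) ^ (2 * s + 1) ≤ (δ + τ * δ) ^ (2 * s + 1) := by gcongr
        have h4 : c ^ 2 ≤ c * δ := by nlinarith
        calc _ ≤ c ^ 2 * ((δ + τ * δ) ^ (2 * s + 1) / (2 * s + 1)) := by gcongr; linarith
          _ ≤ _ := by gcongr
    _ = _ := by
        have : δ + τ * δ = δ * (1 + τ) := by ring
        rw [this, mul_pow]
        ring

theorem integral_abs_pow_mul_le {a b y δ τ : ℝ} (s : ℕ) (hτ : 0 ≤ τ) (hy : y ∈ Set.Icc a b)
    (ha : y - a ≤ δ) (hb : b - y ≤ δ) :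
    ∫ t in a..b, |t - y| ^ 2 * (|t - y| + τ * δ) ^ (2 * s) ≤
      (b - a) * (δ ^ (2 * s + 2) * (1 + τ) ^ (2 * s + 1) / (2 * s + 1)) := by
  have hint : ∀ p q, IntervalIntegrable
      (fun t => |t - y| ^ 2 * (|t - y| + τ * δ) ^ (2 * s)) volume p q := fun p q =>
    (by fun_prop : Continuous fun t => |t - y| ^ 2 * (|t - y| + τ * δ) ^ (2 * s)).intervalIntegrable
      _ _
  rw [← intervalIntegral.integral_add_adjacent_intervals (hint a y) (hint y b)]
  have h1 : ∫ t in a..y, |t - y| ^ 2 * (|t - y| + τ * δ) ^ (2 * s) =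
      ∫ u in (0 : ℝ)..(y - a), u ^ 2 * (u + τ * δ) ^ (2 * s) := by
    have := intervalIntegral.integral_comp_sub_left
      (fun u => u ^ 2 * (u + τ * δ) ^ (2 * s)) (a := a) (b := y) y
    rw [sub_self] at this
    rw [← this]
    refine intervalIntegral.integral_congr fun t ht => ?_
    rw [Set.uIcc_of_le hy.1] at ht
    rw [abs_sub_comm, abs_of_nonneg (sub_nonneg.2 ht.2)]
  have h2 : ∫ t in y..b, |t - y| ^ 2 * (|t - y| + τ * δ) ^ (2 * s) =
      ∫ u in (0 : ℝ)..(b - y), u ^ 2 * (u + τ * δ) ^ (2 * s) := by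
    have := intervalIntegral.integral_comp_sub_right
      (fun u => u ^ 2 * (u + τ * δ) ^ (2 * s)) (a := y) (b := b) y
    rw [sub_self] at this
    rw [← this]
    refine intervalIntegral.integral_congr fun t ht => ?_
    rw [Set.uIcc_of_le hy.2] at ht
    rw [abs_of_nonneg (sub_nonneg.2 ht.1)]
  rw [h1, h2]
  have h3 := integral_pow_mul_le s hτ (sub_nonneg.2 hy.1) ha
  have h4 := integral_pow_mul_le s hτ (sub_nonneg.2 hy.2) hb
  linarith

/-- The maximum of `‖u‖²` over a short interval is controlled by the means of `‖u‖²` and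
`‖u'‖²`. -/
theorem mul_norm_sq_le {u u' : ℝ → ℂ} (hu : ∀ t, HasDerivAt u (u' t) t) (hu' : Continuous u')
    {a b ξ δ θ : ℝ} (hξ : ξ ∈ Set.Icc a b) (hab : b - a ≤ 2 * δ) (hθ : 0 < θ) :
    (b - a) * ‖u ξ‖ ^ 2 ≤ (1 + θ) * (∫ t in a..b, ‖u t‖ ^ 2) +
      (1 + θ⁻¹) * ((4 * δ / Real.pi) ^ 2 * ∫ t in a..b, ‖u' t‖ ^ 2) := by
  have huc : Continuous u := continuous_iff_continuousAt.2 fun t => (hu t).continuousAt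
  have hle : a ≤ b := hξ.1.trans hξ.2
  have hpi := Real.pi_pos
  have h1 : ∫ t in a..b, ‖u ξ‖ ^ 2 ≤
      ∫ t in a..b, ((1 + θ) * ‖u t‖ ^ 2 + (1 + θ⁻¹) * ‖u t - u ξ‖ ^ 2) := by
    refine intervalIntegral.integral_mono_on hle (by simp)
      ((by fun_prop : Continuous _).intervalIntegrable _ _) fun t _ => ?_
    have := norm_add_sq_le hθ (u t) (u ξ - u t)
    rwa [add_sub_cancel, norm_sub_rev] at this
  rw [intervalIntegral.integral_const, smul_eq_mul, intervalIntegral.integral_add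
    ((by fun_prop : Continuous _).intervalIntegrable _ _)
    ((by fun_prop : Continuous _).intervalIntegrable _ _), intervalIntegral.integral_const_mul,
    intervalIntegral.integral_const_mul] at h1
  refine h1.trans ?_
  gcongr
  refine (integral_norm_sub_sq_le hu hu' hξ).trans ?_
  have h0 : 0 ≤ ∫ t in a..b, ‖u' t‖ ^ 2 :=
    intervalIntegral.integral_nonneg hle fun _ _ => by positivity
  have hba : 0 ≤ b - a := sub_nonneg.2 hle
  gcongr ?_ * _
  gcongr ?_ ^ 2
  gcongr ?_ / _
  linarith

/-- The weight integral carries the factor `b - a`, exactly what `mul_norm_sq_le` needs to trade the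
maximum of the derivative for integrals, with no lower bound on the length of the cell. -/
theorem integral_norm_sub_interpolate_sq_le {a b δ τ θ : ℝ} {s : ℕ} (F : ℕ → ℝ → ℂ)
    (hF : ∀ k t, HasDerivAt (F k) (F (k + 1) t) t) {x : Fin (s + 1) → ℝ}
    (hx : Function.Injective x) (hxab : ∀ m, x m ∈ Set.Icc a b) (ha : x 0 - a ≤ δ)
    (hb : b - x 0 ≤ δ) (hx0 : ∀ m, |x m - x 0| ≤ τ * δ) (hτ : 0 ≤ τ) (hθ : 0 < θ) :
    ∫ t in a..b, ‖F 0 t - (Lagrange.interpolate Finset.univ (fun m => (x m : ℂ))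
        fun m => F 0 (x m)).eval (t : ℂ)‖ ^ 2 ≤
      δ ^ (2 * s + 2) * (1 + τ) ^ (2 * s + 1) / (2 * s + 1) / ((s + 1).factorial : ℝ) ^ 2 *
        ((1 + θ) * (∫ t in a..b, ‖F (s + 1) t‖ ^ 2) +
          (1 + θ⁻¹) * ((4 * δ / Real.pi) ^ 2 * ∫ t in a..b, ‖F (s + 2) t‖ ^ 2)) := by
  have hFc : ∀ k, Continuous (F k) := fun k =>
    continuous_iff_continuousAt.2 fun t => (hF k t).continuousAt
  have hab : a ≤ b := (hxab 0).1.trans (hxab 0).2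
  have hδ : 0 ≤ δ := (sub_nonneg.2 (hxab 0).1).trans ha
  obtain ⟨ξ, hξ, hmax⟩ := isCompact_Icc.exists_isMaxOn (Set.nonempty_Icc.2 hab)
    (hFc (s + 1)).norm.continuousOn
  set M := ‖F (s + 1) ξ‖ with hM
  set Z := ((s + 1).factorial : ℝ) with hZ
  set K := δ ^ (2 * s + 2) * (1 + τ) ^ (2 * s + 1) / (2 * s + 1) with hK
  have hZ0 : 0 < Z := by positivity
  have hpt : ∀ t ∈ Set.Icc a b, ‖F 0 t - (Lagrange.interpolate Finset.univ (fun m => (x m : ℂ))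
      fun m => F 0 (x m)).eval (t : ℂ)‖ ^ 2 ≤
      (M / Z) ^ 2 * (|t - x 0| ^ 2 * (|t - x 0| + τ * δ) ^ (2 * s)) := by
    intro t ht
    have h1 := norm_sub_eval_interpolate_le F hF hx hxab (fun ξ hξ => hmax hξ) ht
    -- The centre keeps its exact distance; only the other `s` nodes pay `τδ`.
    have h2 : ∏ m, |t - x m| ≤ |t - x 0| * (|t - x 0| + τ * δ) ^ s := by
      rw [Fin.prod_univ_succ]
      gcongr
      calc ∏ i : Fin s, |t - x i.succ| ≤ ∏ _i : Fin s, (|t - x 0| + τ * δ) := by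
            refine Finset.prod_le_prod (fun _ _ => abs_nonneg _) fun i _ => ?_
            have h3 := abs_sub_le t (x 0) (x i.succ)
            have h4 := hx0 i.succ
            rw [abs_sub_comm] at h4
            linarith
        _ = _ := by simp
    calc _ ≤ (M / Z * (|t - x 0| * (|t - x 0| + τ * δ) ^ s)) ^ 2 := by
          refine pow_le_pow_left₀ (norm_nonneg _) (h1.trans ?_) 2
          gcongr
      _ = _ := by ring
  have hcont : Continuous fun t : ℝ => ‖F 0 t - (Lagrange.interpolate Finset.univ
      (fun m => (x m : ℂ)) fun m => F 0 (x m)).eval (t : ℂ)‖ ^ 2 :=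
    (((hFc 0).sub ((Polynomial.continuous _).comp Complex.continuous_ofReal)).norm).pow 2
  calc _ ≤ ∫ t in a..b, (M / Z) ^ 2 * (|t - x 0| ^ 2 * (|t - x 0| + τ * δ) ^ (2 * s)) :=
        intervalIntegral.integral_mono_on hab (hcont.intervalIntegrable _ _)
          ((by fun_prop : Continuous _).intervalIntegrable _ _) hpt
    _ = (M / Z) ^ 2 * ∫ t in a..b, |t - x 0| ^ 2 * (|t - x 0| + τ * δ) ^ (2 * s) :=
        intervalIntegral.integral_const_mul _ _
    _ ≤ (M / Z) ^ 2 * ((b - a) * K) := by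
        gcongr
        exact integral_abs_pow_mul_le s hτ (hxab 0) ha hb
    _ = K / Z ^ 2 * ((b - a) * M ^ 2) := by ring
    _ ≤ _ := by
        gcongr
        exact mul_norm_sq_le (hF (s + 1)) (hFc (s + 2)) hξ (by linarith) hθ

theorem interpOp_apply_of_mem {s : ℕ} {V : Set ℝ} (nodes : Fin (s + 1) → ℝ) (g : ℝ → ℂ) {t : ℝ}
    (ht : t ∈ V) : interpOp V nodes g t = (Lagrange.interpolate Finset.univ
      (fun m => (nodes m : ℂ)) fun m => g (nodes m)).eval (t : ℂ)  := by
  simp [interpOp, ht]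

/-- The local interpolants approximate a bandlimited function in `L²`. -/
theorem IsBunchedSamplingSet.interpolation_error {I : Type*} {s : ℕ} {x : I → Fin (s + 1) → ℝ}
    {δ τ : ℝ} (hx : IsBunchedSamplingSet s x δ τ) (hτ : 0 ≤ τ) {Ω : Set ℝ} (hΩ : IsCompact Ω)
    (hm : 0 < bandRadius Ω) {f : Lp ℂ 2 (volume : Measure ℝ)} (hf : f ∈ bandlimited Ω) :
    Summable (fun n => ∫ t in voronoi (fun k => x k 0) n,
      ‖pointValue f t - interpOp (voronoi (fun k => x k 0) n) (x n) (pointValue f) t‖ ^ 2) ∧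
    ∑' n, ∫ t in voronoi (fun k => x k 0) n,
      ‖pointValue f t - interpOp (voronoi (fun k => x k 0) n) (x n) (pointValue f) t‖ ^ 2 ≤
      (√((1 + τ) / (2 * s + 1)) * hTilde s τ (δ * bandRadius Ω)) ^ 2 * ‖f‖ ^ 2 := by
  obtain ⟨D, hD0, hDΩ, hDn, hDd⟩ := exists_iterated_derivs hΩ hf
  have hδ := hx.density_pos
  have hpi := Real.pi_pos
  set m := bandRadius Ω with hm'
  -- The optimal weight: `(1 + θ) + (1 + θ⁻¹) θ² = (1 + θ)²`, and `1 + θ` is the linear factor of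
  -- `h̃`.
  set θ := 4 * (δ * m) / Real.pi with hθ'
  have hθ : 0 < θ := by positivity
  set K := δ ^ (2 * s + 2) * (1 + τ) ^ (2 * s + 1) / (2 * s + 1) / ((s + 1).factorial : ℝ) ^ 2
    with hK
  have hK0 : 0 ≤ K := by positivity
  have hsum : ∀ k, HasSum (fun n => ∫ t in voronoi (fun k => x k 0) n, ‖pointValue (D k) t‖ ^ 2)
      (‖D k‖ ^ 2) := fun k => by
    rw [norm_sq_eq_integral_pointValue hΩ (hDΩ k)]
    exact hx.hasSum_integral_voronoi (integrable_norm_sq_pointValue hΩ (hDΩ k))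
  have hR := (((hsum (s + 1)).mul_left (1 + θ)).add
    (((hsum (s + 2)).mul_left ((4 * δ / Real.pi) ^ 2)).mul_left (1 + θ⁻¹))).mul_left K
  have hle : ∀ n, ∫ t in voronoi (fun k => x k 0) n,
      ‖pointValue f t - interpOp (voronoi (fun k => x k 0) n) (x n) (pointValue f) t‖ ^ 2 ≤
      K * ((1 + θ) * (∫ t in voronoi (fun k => x k 0) n, ‖pointValue (D (s + 1)) t‖ ^ 2) +
        (1 + θ⁻¹) * ((4 * δ / Real.pi) ^ 2 *
          ∫ t in voronoi (fun k => x k 0) n, ‖pointValue (D (s + 2)) t‖ ^ 2)) := by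
    intro n
    rw [setIntegral_congr_fun (isClosed_voronoi _ n).measurableSet (fun t ht => by
      rw [interpOp_apply_of_mem (x n) (pointValue f) ht])]
    have hmem := hx.mem_voronoi n
    obtain ⟨a, b, hV, h0, ha, hb⟩ := hx.exists_voronoi_eq_Icc n
    rw [hV] at hmem ⊢
    have h := integral_norm_sub_interpolate_sq_le (fun k => pointValue (D k)) hDd
      (hx.bunch_injective n) hmem ha hb (hx.abs_node_sub_le n) hτ hθ
    rw [hD0] at h
    simpa only [intervalIntegral.integral_of_le (h0.1.trans h0.2), ← integral_Icc_eq_integral_Ioc]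
      using h
  have hs : Summable (fun n => ∫ t in voronoi (fun k => x k 0) n,
      ‖pointValue f t - interpOp (voronoi (fun k => x k 0) n) (x n) (pointValue f) t‖ ^ 2) :=
    Summable.of_nonneg_of_le (fun n => integral_nonneg fun _ => by positivity) hle hR.summable
  refine ⟨hs, (hs.tsum_le_tsum hle hR.summable).trans ?_⟩
  rw [hR.tsum_eq]
  calc _ ≤ K * ((1 + θ) * (m ^ (s + 1) * ‖f‖) ^ 2 +
        (1 + θ⁻¹) * ((4 * δ / Real.pi) ^ 2 * (m ^ (s + 2) * ‖f‖) ^ 2)) := by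
        gcongr
        · exact hDn _
        · exact hDn _
    _ = K * ((1 + θ) * (m ^ (s + 1) * ‖f‖) ^ 2 +
        (1 + θ⁻¹) * (θ ^ 2 * (m ^ (s + 1) * ‖f‖) ^ 2)) := by
        rw [hθ']
        ring
    _ = K * (m ^ (s + 1) * (1 + θ)) ^ 2 * ‖f‖ ^ 2 := by
        field_simp
        ring
    _ = _ := by
        rw [mul_pow (√_), Real.sq_sqrt (by positivity), hTilde, ← hθ', hK]
        field_simp
        ring

/-! ### The interpolation operators and their frame bounds. -/

theorem isIdempotentElem_interpOp {s : ℕ} {V : Set ℝ} {nodes : Fin (s + 1) → ℝ}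
    (hinj : Function.Injective nodes) (hV : ∀ m, nodes m ∈ V) :
    IsIdempotentElem (interpOp V nodes) := by
  refine LinearMap.ext fun g => ?_
  have hinj' : Function.Injective fun m => (nodes m : ℂ) :=
    Complex.ofReal_injective.comp hinj
  have h : (fun m => interpOp V nodes g (nodes m)) = fun m => g (nodes m) := by
    funext m
    rw [interpOp_apply_of_mem nodes g (hV m)]
    exact Lagrange.eval_interpolate_at_node _ hinj'.injOn (Finset.mem_univ m)
  funext t
  rw [Module.End.mul_apply]
  by_cases ht : t ∈ V
  · rw [interpOp_apply_of_mem _ _ ht, interpOp_apply_of_mem _ _ ht, h]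
  · simp [interpOp, ht]

theorem memLp_indicator_of_continuous {V : Set ℝ} (hV : IsCompact V) {g : ℝ → ℂ}
    (hg : Continuous g) : MemLp (V.indicator g) 2 (volume : Measure ℝ) :=
  (memLp_indicator_iff_restrict hV.measurableSet).2 <|
    (memLp_two_iff_integrable_sq_norm hg.aestronglyMeasurable).2 <|
      (hg.norm.pow 2).continuousOn.integrableOn_compact hV

/-- The operator taking data at the nodes to the interpolation polynomial on `V`. -/
theorem exists_interpolation_map {s : ℕ} {V : Set ℝ} (hV : IsCompact V)
    (nodes : Fin (s + 1) → ℝ) :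
    ∃ T : (Fin (s + 1) → ℂ) →ₗ[ℂ] supportedIn V, ∀ g : ℝ → ℂ,
      ((T fun m => g (nodes m) : Lp ℂ 2 (volume : Measure ℝ)) : ℝ → ℂ) =ᵐ[volume]
        interpOp V nodes g := by
  have hL : ∀ c : Fin (s + 1) → ℂ, MemLp (V.indicator fun t : ℝ =>
      (Lagrange.interpolate Finset.univ (fun m => (nodes m : ℂ)) c).eval (t : ℂ)) 2
      (volume : Measure ℝ) := fun c =>
    memLp_indicator_of_continuous hV
      ((Polynomial.continuous _).comp Complex.continuous_ofReal)
  refine ⟨{ toFun := fun c => ⟨(hL c).toLp _, ?_⟩, map_add' := ?_, map_smul' := ?_ }, ?_⟩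
  · change ∀ᵐ t : ℝ, t ∉ V → (hL c).toLp _ t = 0
    filter_upwards [(hL c).coeFn_toLp] with t h1 h2
    rw [h1, Set.indicator_of_notMem h2]
  · intro c d
    refine Subtype.ext ?_
    change (hL (c + d)).toLp _ = (hL c).toLp _ + (hL d).toLp _
    rw [← MemLp.toLp_add]
    refine MemLp.toLp_congr _ _ (ae_of_all _ fun t => ?_)
    by_cases ht : t ∈ V <;> simp only [Pi.add_apply, Set.indicator, ht, if_true, if_false, map_add,
      Polynomial.eval_add, add_zero]
  · intro k c
    refine Subtype.ext ?_
    change (hL (k • c)).toLp _ = k • (hL c).toLp _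
    rw [← MemLp.toLp_const_smul]
    refine MemLp.toLp_congr _ _ (ae_of_all _ fun t => ?_)
    by_cases ht : t ∈ V <;> simp only [Pi.smul_apply, Set.indicator, ht, if_true, if_false,
      map_smul, Polynomial.eval_smul, smul_zero]
  · intro g
    exact (hL _).coeFn_toLp

theorem integral_indicator_norm_sq {V : Set ℝ} (hV : MeasurableSet V) {s : ℕ}
    (nodes : Fin (s + 1) → ℝ) (g : ℝ → ℂ) {h : Lp ℂ 2 (volume : Measure ℝ)}
    (hh : (h : ℝ → ℂ) =ᵐ[volume] interpOp V nodes g) :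
    ‖h‖ ^ 2 = ∫ t in V, ‖interpOp V nodes g t‖ ^ 2 := by
  rw [norm_sq_eq_integral_norm_sq, ← integral_indicator hV]
  refine integral_congr_ae ?_
  filter_upwards [hh] with t ht
  rw [ht]
  by_cases htV : t ∈ V <;> simp [interpOp, htV]

namespace IsBunchedSamplingSet

variable {I : Type*} {s : ℕ} {x : I → Fin (s + 1) → ℝ} {δ τ : ℝ}

theorem isCompact_voronoi (hx : IsBunchedSamplingSet s x δ τ) (n : I) :
    IsCompact (voronoi (fun k => x k 0) n) := by
  obtain ⟨a, b, hV, -⟩ := hx.exists_voronoi_eq_Icc n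
  rw [hV]
  exact isCompact_Icc

/-- The fusion frame property follows from two-sided bounds for `∑ ∫_{V_n} |p_n(f)|²`. -/
theorem isBunchedFusionFrame (hx : IsBunchedSamplingSet s x δ τ) {Ω : Set ℝ} (hΩ : IsCompact Ω)
    {A B : ℝ} (hA : 0 < A) (hB : 0 < B)
    (h : ∀ f ∈ bandlimited Ω, ∃ S : ℝ, HasSum (fun n => ∫ t in voronoi (fun k => x k 0) n,
      ‖interpOp (voronoi (fun k => x k 0) n) (x n) (pointValue f) t‖ ^ 2) S ∧
      A * ‖f‖ ^ 2 ≤ S ∧ S ≤ B * ‖f‖ ^ 2) :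
    IsBunchedFusionFrame Ω s x A B := by
  refine ⟨fun n => isIdempotentElem_interpOp (hx.bunch_injective n) (hx.mem_voronoi n), ?_⟩
  choose T hT using fun n => exists_interpolation_map (hx.isCompact_voronoi n) (x n)
  let ev : ∀ _ : I, bandlimited Ω →ₗ[ℂ] (Fin (s + 1) → ℂ) := fun n =>
    { toFun := fun f m => pointValue f (x n m)
      map_add' := fun f g => by
        funext m
        simp [pointValue_add hΩ f.2 g.2]
      map_smul' := fun c f => by
        funext m
        simp [pointValue_smul hΩ c f.2] }
  have hTe : ∀ n (f : bandlimited Ω),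
      (((T n ∘ₗ ev n) f : Lp ℂ 2 (volume : Measure ℝ)) : ℝ → ℂ) =ᵐ[volume]
        interpOp (voronoi (fun k => x k 0) n) (x n) (pointValue f) := fun n f =>
    hT n (pointValue f)
  have hnorm : ∀ n (f : bandlimited Ω), ‖(T n ∘ₗ ev n) f‖ ^ 2 =
      ∫ t in voronoi (fun k => x k 0) n,
        ‖interpOp (voronoi (fun k => x k 0) n) (x n) (pointValue f) t‖ ^ 2 := fun n f =>
    integral_indicator_norm_sq (isClosed_voronoi _ n).measurableSet (x n) (pointValue f) (hTe n f)
  have hbound : ∀ n (f : bandlimited Ω), ‖(T n ∘ₗ ev n) f‖ ≤ √B * ‖f‖ := by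
    intro n f
    obtain ⟨S, hS, -, hSB⟩ := h f f.2
    -- One term of a sum of nonnegative terms: the upper frame bound already makes each operator
    -- bounded.
    have h1 := (le_hasSum hS n fun k _ => integral_nonneg fun _ => by positivity).trans hSB
    rw [← hnorm] at h1
    rw [← Real.sqrt_sq (norm_nonneg ((T n ∘ₗ ev n) f)), ← Real.sqrt_sq (norm_nonneg f),
      ← Real.sqrt_mul hB.le]
    exact Real.sqrt_le_sqrt h1
  refine ⟨fun n => (T n ∘ₗ ev n).mkContinuous _ (hbound n), hTe, ?_⟩
  have hsum : ∀ f : bandlimited Ω, ∃ S : ℝ, HasSum (fun n : I => (1 : ℝ) *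
      ‖(T n ∘ₗ ev n).mkContinuous _ (hbound n) f‖ ^ 2) S ∧ A * ‖f‖ ^ 2 ≤ S ∧
        S ≤ B * ‖f‖ ^ 2 := by
    intro f
    obtain ⟨S, hS, hSA, hSB⟩ := h f f.2
    refine ⟨S, ?_, hSA, hSB⟩
    simpa only [one_mul, LinearMap.mkContinuous_apply, hnorm] using hS
  refine ⟨hA, hB, fun _ => one_pos, fun n => ?_, fun f => ?_, fun f => ?_, fun f => ?_⟩
  -- The operator factors through `ℂ^(s+1)`, so its range is finite-dimensional and hence closed.
  · have hfin : FiniteDimensional ℂ (LinearMap.range (T n ∘ₗ ev n)) :=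
      Submodule.finiteDimensional_of_le (LinearMap.range_comp_le_range (ev n) (T n))
    exact Submodule.closed_of_finiteDimensional (LinearMap.range (T n ∘ₗ ev n))
  · obtain ⟨S, hS, -⟩ := hsum f
    exact hS.summable
  · obtain ⟨S, hS, hSA, -⟩ := hsum f
    exact hSA.trans_eq hS.tsum_eq.symm
  · obtain ⟨S, hS, -, hSB⟩ := hsum f
    exact hS.tsum_eq.trans_le hSB

/-- This is the triangle inequality for the glued interpolant, done cell by cell in quadratic form
so that no global function has to be built. The weights `η` and `η/(1 - η)` make the summed bounds
exactly `(1 + η)²` and `(1 - η)²`. -/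
theorem isBunchedFusionFrame_of_error (hx : IsBunchedSamplingSet s x δ τ) {Ω : Set ℝ}
    (hΩ : IsCompact Ω) {η : ℝ} (hη : 0 < η) (hη1 : η < 1)
    (h : ∀ f ∈ bandlimited Ω, Summable (fun n => ∫ t in voronoi (fun k => x k 0) n,
      ‖pointValue f t - interpOp (voronoi (fun k => x k 0) n) (x n) (pointValue f) t‖ ^ 2) ∧
      ∑' n, ∫ t in voronoi (fun k => x k 0) n,
        ‖pointValue f t - interpOp (voronoi (fun k => x k 0) n) (x n) (pointValue f) t‖ ^ 2 ≤
        η ^ 2 * ‖f‖ ^ 2) :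
    IsBunchedFusionFrame Ω s x ((1 - η) ^ 2) ((1 + η) ^ 2) := by
  refine hx.isBunchedFusionFrame hΩ (pow_pos (sub_pos.2 hη1) 2) (by positivity) fun f hf => ?_
  obtain ⟨hE, hEle⟩ := h f hf
  have hc := continuous_pointValue hΩ hf
  have hI : HasSum (fun n => ∫ t in voronoi (fun k => x k 0) n, ‖pointValue f t‖ ^ 2)
      (‖f‖ ^ 2) := by
    rw [norm_sq_eq_integral_pointValue hΩ hf]
    exact hx.hasSum_integral_voronoi (integrable_norm_sq_pointValue hΩ hf)
  have hcoe : ∀ n, Set.EqOn (interpOp (voronoi (fun k => x k 0) n) (x n) (pointValue f))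
      (fun t : ℝ => (Lagrange.interpolate Finset.univ (fun m => (x n m : ℂ))
        fun m => pointValue f (x n m)).eval (t : ℂ)) (voronoi (fun k => x k 0) n) := fun n t ht =>
    interpOp_apply_of_mem (x n) (pointValue f) ht
  have hp : ∀ n, ContinuousOn (interpOp (voronoi (fun k => x k 0) n) (x n) (pointValue f))
      (voronoi (fun k => x k 0) n) := fun n =>
    (((Polynomial.continuous _).comp Complex.continuous_ofReal).continuousOn).congr (hcoe n)
  have hint : ∀ n (g : ℝ → ℂ), ContinuousOn g (voronoi (fun k => x k 0) n) →
      IntegrableOn (fun t => ‖g t‖ ^ 2) (voronoi (fun k => x k 0) n) := fun n g hg =>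
    (hg.norm.pow 2).integrableOn_compact (hx.isCompact_voronoi n)
  have hdif : ∀ n, IntegrableOn (fun t => ‖pointValue f t -
      interpOp (voronoi (fun k => x k 0) n) (x n) (pointValue f) t‖ ^ 2)
      (voronoi (fun k => x k 0) n) := fun n => hint n _ (hc.continuousOn.sub (hp n))
  have hup : ∀ n, ∫ t in voronoi (fun k => x k 0) n,
      ‖interpOp (voronoi (fun k => x k 0) n) (x n) (pointValue f) t‖ ^ 2 ≤
      (1 + η) * (∫ t in voronoi (fun k => x k 0) n, ‖pointValue f t‖ ^ 2) +
      (1 + η⁻¹) * ∫ t in voronoi (fun k => x k 0) n,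
        ‖pointValue f t - interpOp (voronoi (fun k => x k 0) n) (x n) (pointValue f) t‖ ^ 2 := by
    intro n
    have i1 := (hint n _ hc.continuousOn).const_mul (1 + η)
    have i2 := (hdif n).const_mul (1 + η⁻¹)
    rw [← integral_const_mul, ← integral_const_mul, ← integral_add i1 i2]
    refine integral_mono (hint n _ (hp n)) (i1.add i2) fun t => ?_
    have := norm_add_sq_le hη (pointValue f t)
      (interpOp (voronoi (fun k => x k 0) n) (x n) (pointValue f) t - pointValue f t)
    rwa [add_sub_cancel, norm_sub_rev] at this
  have hlow : ∀ n, (1 - η) * (∫ t in voronoi (fun k => x k 0) n, ‖pointValue f t‖ ^ 2) -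
      (η⁻¹ - 1) * (∫ t in voronoi (fun k => x k 0) n,
        ‖pointValue f t - interpOp (voronoi (fun k => x k 0) n) (x n) (pointValue f) t‖ ^ 2) ≤
      ∫ t in voronoi (fun k => x k 0) n,
        ‖interpOp (voronoi (fun k => x k 0) n) (x n) (pointValue f) t‖ ^ 2 := by
    intro n
    have i1 := (hint n _ hc.continuousOn).const_mul (1 - η)
    have i2 := (hdif n).const_mul (η⁻¹ - 1)
    rw [← integral_const_mul, ← integral_const_mul, ← integral_sub i1 i2]
    refine integral_mono (i1.sub i2) (hint n _ (hp n)) fun t => ?_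
    have hη2 : 0 < 1 - η := sub_pos.2 hη1
    have h1 := norm_add_sq_le (div_pos hη hη2)
      (interpOp (voronoi (fun k => x k 0) n) (x n) (pointValue f) t)
      (pointValue f t - interpOp (voronoi (fun k => x k 0) n) (x n) (pointValue f) t)
    rw [add_sub_cancel] at h1
    have h2 := mul_le_mul_of_nonneg_left h1 hη2.le
    have e1 : (1 - η) * (1 + η / (1 - η)) = 1 := by field_simp; ring
    have e2 : (1 - η) * (1 + (η / (1 - η))⁻¹) = η⁻¹ - 1 := by field_simp; ring
    rw [mul_add, ← mul_assoc, ← mul_assoc, e1, e2] at h2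
    beta_reduce
    linarith
  have hsU := (hI.mul_left (1 + η)).add (hE.hasSum.mul_left (1 + η⁻¹))
  have hsL := (hI.mul_left (1 - η)).sub (hE.hasSum.mul_left (η⁻¹ - 1))
  have hs := Summable.of_nonneg_of_le (fun n => integral_nonneg fun _ => by positivity) hup
    hsU.summable
  refine ⟨_, hs.hasSum, ?_, ?_⟩
  · refine le_trans ?_ (hasSum_le hlow hsL hs.hasSum)
    have h0 : 0 ≤ η⁻¹ - 1 := sub_nonneg.2 ((one_le_inv₀ hη).2 hη1.le)
    have h1 := mul_le_mul_of_nonneg_left hEle h0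
    have h2 : (1 - η) * ‖f‖ ^ 2 - (η⁻¹ - 1) * (η ^ 2 * ‖f‖ ^ 2) = (1 - η) ^ 2 * ‖f‖ ^ 2 := by
      field_simp
    linarith
  · refine (hasSum_le hup hs.hasSum hsU).trans ?_
    have h1 := mul_le_mul_of_nonneg_left hEle (show 0 ≤ 1 + η⁻¹ by positivity)
    have h2 : (1 + η) * ‖f‖ ^ 2 + (1 + η⁻¹) * (η ^ 2 * ‖f‖ ^ 2) = (1 + η) ^ 2 * ‖f‖ ^ 2 := by
      field_simp
      ring
    linarith

/-- Below the threshold there are frame bounds, which are controlled by `h̃`. -/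
theorem exists_isBunchedFusionFrame (hx : IsBunchedSamplingSet s x δ τ) (hs : 1 ≤ s)
    (hτ : 0 < τ) (hτ1 : τ ≤ 1) {Ω : Set ℝ} (hΩ : IsCompact Ω)
    (hlt : δ * bandRadius Ω < ((s : ℝ) + 1) / ((1 + τ) * Real.exp 1)) :
    ∃ A B : ℝ, IsBunchedFusionFrame Ω s x A B ∧
      (hTilde s τ (δ * bandRadius Ω) < 1 → (1 - hTilde s τ (δ * bandRadius Ω)) ^ 2 ≤ A) ∧
      B ≤ (1 + hTilde s τ (δ * bandRadius Ω)) ^ 2 := by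
  have hδ := hx.density_pos
  rcases (bandRadius_nonneg Ω).eq_or_lt with h0 | hm
  · have hz : hTilde s τ (δ * bandRadius Ω) = 0 := by simp [← h0, hTilde]
    refine ⟨1, 1, hx.isBunchedFusionFrame hΩ one_pos one_pos fun f hf => ⟨0, ?_⟩, ?_, ?_⟩
    · have hf0 := eq_zero_of_bandRadius_eq_zero hΩ h0.symm hf
      subst hf0
      have hp : pointValue 0 = 0 := by
        have := pointValue_smul hΩ 0 hf
        rwa [zero_smul, zero_smul] at this
      simp [hp, hasSum_zero]
    · simp [hz]
    · simp [hz]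
  · have hz : 0 < δ * bandRadius Ω := by positivity
    have hη1 := sqrt_mul_hTilde_lt_one hτ.le hz.le hlt
    have hh := hTilde_pos (s := s) hτ.le hz
    -- Here `s ≥ 1` matters: for `s = 0` the ratio is `1 + τ > 1`.
    have hsq : √((1 + τ) / (2 * s + 1)) ≤ 1 := by
      rw [Real.sqrt_le_one, div_le_one (by positivity)]
      have : (1 : ℝ) ≤ s := by exact_mod_cast hs
      linarith
    have hle : √((1 + τ) / (2 * s + 1)) * hTilde s τ (δ * bandRadius Ω) ≤
        hTilde s τ (δ * bandRadius Ω) := mul_le_of_le_one_left hh.le hsq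
    have hη : 0 < √((1 + τ) / (2 * s + 1)) * hTilde s τ (δ * bandRadius Ω) := by positivity
    refine ⟨_, _, hx.isBunchedFusionFrame_of_error hΩ hη hη1 fun f hf =>
      hx.interpolation_error hτ.le hΩ hm hf, fun h1 => ?_, ?_⟩
    · exact pow_le_pow_left₀ (sub_nonneg.2 h1.le) (by linarith) 2
    · exact pow_le_pow_left₀ (by positivity) (by linarith) 2

end IsBunchedSamplingSet

/-! ### The main theorem. -/

theorem mainTheorem9 :
    (∀ τ : ℝ, 0 < τ → τ ≤ 1 →
      Asymptotics.IsEquivalent atTop (fun s : ℕ => HTilde s τ 1)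
        (fun s : ℕ => ((s : ℝ) + 1) / ((1 + τ) * Real.exp 1))) ∧
    (∃ S : ℕ, ∀ s : ℕ, S ≤ s → ∀ (I : Type u) (x : I → Fin (s + 1) → ℝ) (δ τ : ℝ) (Ω : Set ℝ),
      0 < τ → τ ≤ 1 → IsCompact Ω → IsBunchedSamplingSet s x δ τ →
      δ * bandRadius Ω < ((s : ℝ) + 1) / ((1 + τ) * Real.exp 1) →
      ∃ A B : ℝ, IsBunchedFusionFrame Ω s x A B ∧
        (δ * bandRadius Ω < HTilde s τ 1 → (1 - hTilde s τ (δ * bandRadius Ω)) ^ 2 ≤ A) ∧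
        B ≤ (1 + hTilde s τ (δ * bandRadius Ω)) ^ 2) ∧
    (∀ ε : ℝ, 0 < ε → ε < 1 →
      ∃ S : ℕ, ∀ s : ℕ, S ≤ s → ∀ (I : Type u) (x : I → Fin (s + 1) → ℝ) (δ τ : ℝ) (Ω : Set ℝ),
        0 < τ → τ ≤ 1 → IsCompact Ω → IsBunchedSamplingSet s x δ τ →
        δ * bandRadius Ω < (1 - ε) * (((s : ℝ) + 1) / ((1 + τ) * Real.exp 1)) →
        ∃ A B : ℝ, IsBunchedFusionFrame Ω s x A B ∧
          (1 - hTilde s τ (δ * bandRadius Ω)) ^ 2 ≤ A ∧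
          B ≤ (1 + hTilde s τ (δ * bandRadius Ω)) ^ 2) := by
  -- For the second claim `S = 1` suffices: the estimate below the threshold holds for every `s`,
  -- and `s ≥ 1` is only needed for `η ≤ h̃`.
  refine ⟨fun τ hτ _ => HTilde_one_isEquivalent hτ.le, ⟨1, ?_⟩, fun ε hε hε1 => ?_⟩
  · intro s hs I x δ τ Ω hτ hτ1 hΩ hx hlt
    obtain ⟨A, B, h, hA, hB⟩ := hx.exists_isBunchedFusionFrame hs hτ hτ1 hΩ hlt
    have hz : 0 ≤ δ * bandRadius Ω := mul_nonneg hx.density_pos.le (bandRadius_nonneg Ω)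
    exact ⟨A, B, h, fun h1 => hA ((hTilde_lt_one_iff s hτ.le hz).2 h1), hB⟩
  · obtain ⟨S, hS⟩ := exists_forall_hTilde_lt_one (c := 1 - ε) (by linarith) (by linarith)
    refine ⟨max S 1, ?_⟩
    intro s hs I x δ τ Ω hτ hτ1 hΩ hx hlt
    have hz : 0 ≤ δ * bandRadius Ω := mul_nonneg hx.density_pos.le (bandRadius_nonneg Ω)
    have hr : 0 < ((s : ℝ) + 1) / ((1 + τ) * Real.exp 1) := by positivity
    obtain ⟨A, B, h, hA, hB⟩ := hx.exists_isBunchedFusionFrame ((le_max_right S 1).trans hs) hτ hτ1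
      hΩ (hlt.trans_le (mul_le_of_le_one_left hr.le (by linarith)))
    refine ⟨A, B, h, hA ?_, hB⟩
    -- By monotonicity, `h̃ < 1` at the fraction `1 - ε` of the threshold passes to `δ m_Ω`, so the
    -- lower bound holds without further condition.
    exact ((hTilde_strictMonoOn s hτ.le) hz (hz.trans hlt.le) hlt).trans
      (hS s ((le_max_left S 1).trans hs) τ hτ.le)
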